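/- Let $n\ge 2$, $m\ge 3$, $\theta>0$, let $\varepsilon_i=\pm1$ ($1\le i\le n$) and $\delta_j=\pm1$ ($1\le j\le m$), and let $g_0$ denote the semi-Euclidean metrics $\sum\varepsilon_i\,dx_i^2$ on $\mathbb R^n$ and $\sum\delta_j\,dy_j^2$ on $\mathbb R^m$. Let $\alpha\in\mathbb R^n$, $\beta\in\mathbb R^m$ be nonzero, $\xi=\sum\alpha_ix_i$, $\zeta=\sum\beta_jy_j$, $\|\alpha\|^2=\sum\varepsilon_i\alpha_i^2$, $\|\beta\|^2=\sum\delta_j\beta_j^2$. Let $I,J\subset\mathbb R$ be open intervals, $\xi_0\in I$, $\zeta_0\in J$, let $\varphi,f>0$ and $h$ be smooth functions of $\xi\in I$, and let $\tau>0$ and $u$ be smooth functions of $\zeta\in J$, with $u$ non-constant. On $\{\xi\in I\}\times\{\zeta\in J\}\subset\mathbb R^n\times\mathbb R^m$ consider the warped product metric $g=\varphi^{-2}g_0+f^2\tau^{-2}g_0$, and on $\{\zeta\in J\}$ the fiber metric $g_F=\tau^{-2}g_0$. Let (S) be the assertion that $g$, with potential $h(\xi)$ and map $u(\zeta)$, is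 a steady gradient Ricci-harmonic soliton, i.e. $$Ric_g+Hess_g\,h-\theta\,du\otimes du=0,\qquad \Delta_g u-g(\nabla u,\nabla h)=0,$$ and that the fiber is steady harmonic-Einstein, i.e. $Ric_{g_F}-\theta\,du\otimes du=0$, $\Delta_{g_F}u=0$. Consider the following conditions (the quantifiers range over real constants, and the equations hold on $I$ or $J$ respectively). (B0) There are $c_1,c_2\in\mathbb R$ with $$h(\xi)=\int_{\xi_0}^{\xi}\varphi^{-2}\Big[\int_{\xi_0}^{s}\Big(m\tfrac{f''}{f}\varphi^2+2m\varphi\varphi'\tfrac{f'}{f}-(n-2)\varphi\varphi''\Big)dr+c_1\Big]ds+c_2 .$$ (F0) $\tau''/\tau\ge0$, and there are $c_3\in\mathbb R$ and a function $\sigma:J\to\{1,-1\}$ such that $\sigma\sqrt{\tfrac{m-2}{\theta}\tfrac{\tau''}{\tau}}$ is continuous and $$u(\zeta)=\int_{\zeta_0}^{\zeta}\sigma\sqrt{\tfrac{m-2}{\theta}\tfrac{\tau''}{\tau}}\,ds+c_3 .$$ (F1) There are $c_1,c_3\in\mathbb R$, $c_2>0$ and a sign $\pm$ such that, with $\ell(\zeta)=(m-2)\zeta+c_1$,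 $\ell\ne0$ on $J$ and $$\tau(\zeta)=c_2|\ell(\zeta)|^{\frac1{2-m}},\qquad u(\zeta)=c_3\pm\frac{\sqrt{2-3m+m^2}\;\ell(\zeta)\log|\ell(\zeta)|}{(m-2)\sqrt{\theta\,\ell(\zeta)^2}} .$$ (B1) There are $k\in\mathbb R$ and a smooth function $z$ on $I$ with $\varphi'/\varphi=k\,f'/f$ and $h'+[(n-2)k-m]f'/f=z\,f'/f$, such that, with $D=\sqrt{m+k^2(n-1)}$, $N_\pm=-k\pm D$, $a=k/D$, one of the following holds. (i) $z$ is a nonzero constant, and there are $N\in\{N_+,N_-\}$, $c_4,c_5>0$ and $b,c_7\in\mathbb R$ with $N\xi+b\neq0$ on $I$ and $$\varphi=\frac{c_4}{|N\xi+b|^{k/N}},\quad f=\frac{c_5}{|N\xi+b|^{1/N}},\quad h=-\frac{m-(n-2)k+N}{N}\ln|N\xi+b|+c_7 .$$ (ii) $z$ is non-constant, $z+k-D$ and $z+k+D$ have no zeros on $I$, and there are $c_6\in\mathbb R$ and a function $\psi$ with $$\frac{\varphi'}{\varphi}=k\frac{f'}{f},\qquad \frac{f'}{f}=\psi,\qquad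 h'=[z+m-k(n-2)]\psi,$$ $$\psi=c_6\,|z+k-D|^{\frac{a-1}2}\,|z+k+D|^{\frac{-a-1}2},\qquad z'=-c_6\,(z+k-D)^{[\frac{a+1}2]}\,(z+k+D)^{[\frac{-a+1}2]},$$ where $x^{[p]}=\operatorname{sgn}(x)|x|^p$ (the ordinary power when $x>0$). Then: 1. If $\|\alpha\|^2=0$ and $\|\beta\|^2=0$, then (S) holds if and only if (B0) and (F0) hold. 2. If $\|\alpha\|^2=0$ and $\|\beta\|^2=1$, then (S) holds if and only if (B0) and (F1) hold. 3. If $\|\alpha\|^2=1$, $\|\beta\|^2=0$ and $f$ is non-constant, then (S) holds if and only if (B1) and (F0) hold. 4. If $\|\alpha\|^2=1$, $\|\beta\|^2=1$ and $f$ is non-constant, then (S) holds if and only if (B1) and (F1) hold. -/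

import Mathlib

open scoped ContDiff

noncomputable section

namespace RicciHarmonic

section Coordinates

variable {ι : Type*} [Fintype ι] [DecidableEq ι]

/-- The partial derivative `∂F/∂xᵢ`. -/
def pd (i : ι) (F : (ι → ℝ) → ℝ) (x : ι → ℝ) : ℝ :=
  fderiv ℝ F x (Pi.single i 1)

/-- `g` is a (smooth) semi-Riemannian metric on the open set `U`, given by its components
`g x i j` in the standard coordinates. -/
structure IsMetricOn (U : Set (ι → ℝ)) (g : (ι → ℝ) → Matrix ι ι ℝ) : Prop where
  isOpen : IsOpen U
  smooth : ∀ i j, ContDiffOn ℝ ∞ (fun x => g x i j) U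
  symm : ∀ x ∈ U, (g x).IsSymm
  nondegenerate : ∀ x ∈ U, (g x).det ≠ 0

/-- Christoffel symbols `Γᵏᵢⱼ` of the Levi-Civita connection of `g`. -/
def christoffel (g : (ι → ℝ) → Matrix ι ι ℝ) (k i j : ι) (x : ι → ℝ) : ℝ :=
  (1 / 2) * ∑ l, (g x)⁻¹ k l *
    (pd i (fun y => g y j l) x + pd j (fun y => g y i l) x - pd l (fun y => g y i j) x)

/-- Components of the Ricci tensor of `g`. -/
def ricci (g : (ι → ℝ) → Matrix ι ι ℝ) (i j : ι) (x : ι → ℝ) : ℝ :=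
  ∑ k, (pd k (christoffel g k i j) x - pd j (christoffel g k i k) x) +
    ∑ k, ∑ l, (christoffel g k k l x * christoffel g l i j x -
      christoffel g k j l x * christoffel g l i k x)

/-- Components of the Hessian (second covariant derivative) of `F`. -/
def hess (g : (ι → ℝ) → Matrix ι ι ℝ) (F : (ι → ℝ) → ℝ) (i j : ι) (x : ι → ℝ) : ℝ :=
  pd i (pd j F) x - ∑ k, christoffel g k i j x * pd k F x

/-- The tension field of a real valued function, i.e. the trace of its Hessian. -/
def tension (g : (ι → ℝ) → Matrix ι ι ℝ) (F : (ι → ℝ) → ℝ) (x : ι → ℝ) : ℝ :=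
  ∑ i, ∑ j, (g x)⁻¹ i j * hess g F i j x

/-- The inner product `g(∇F, ∇G)` of two gradients. -/
def gradInner (g : (ι → ℝ) → Matrix ι ι ℝ) (F G : (ι → ℝ) → ℝ) (x : ι → ℝ) : ℝ :=
  ∑ i, ∑ j, (g x)⁻¹ i j * pd i F x * pd j G x

/-- `(U, g)` with potential `h`, real valued map `u`, coupling constant `θ` and constant `lam` is
a gradient Ricci-harmonic soliton. -/
structure IsGRHS (U : Set (ι → ℝ)) (g : (ι → ℝ) → Matrix ι ι ℝ) (h u : (ι → ℝ) → ℝ)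
    (θ lam : ℝ) : Prop where
  metric : IsMetricOn U g
  smooth_h : ContDiffOn ℝ ∞ h U
  smooth_u : ContDiffOn ℝ ∞ u U
  theta_nonneg : 0 ≤ θ
  soliton : ∀ x ∈ U, ∀ i j,
    ricci g i j x + hess g h i j x - θ * (pd i u x * pd j u x) = lam * g x i j
  harmonic : ∀ x ∈ U, tension g u x - gradInner g u h x = 0

/-- `(U, g)` with the real valued map `u` is harmonic-Einstein with constant `ρ`. -/
structure IsHarmonicEinstein (U : Set (ι → ℝ)) (g : (ι → ℝ) → Matrix ι ι ℝ)
    (u : (ι → ℝ) → ℝ) (θ ρ : ℝ) : Prop where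
  metric : IsMetricOn U g
  smooth_u : ContDiffOn ℝ ∞ u U
  theta_nonneg : 0 ≤ θ
  einstein : ∀ x ∈ U, ∀ i j, ricci g i j x - θ * (pd i u x * pd j u x) = ρ * g x i j
  harmonic : ∀ x ∈ U, tension g u x = 0

/-- The metric `φ⁻² g₀`, conformal to the semi-Euclidean metric `(g₀)ᵢⱼ = εᵢ δᵢⱼ`. -/
def conformalMetric (ε : ι → ℝ) (φ : (ι → ℝ) → ℝ) (x : ι → ℝ) : Matrix ι ι ℝ :=
  Matrix.diagonal fun i => ε i / φ x ^ 2

/-- The linear function `x ↦ ∑ αᵢ xᵢ`. -/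
def lin (α : ι → ℝ) (x : ι → ℝ) : ℝ := ∑ i, α i * x i

/-- The semi-Euclidean square norm `‖α‖² = ∑ εᵢ αᵢ²`. -/
def sqNorm (ε α : ι → ℝ) : ℝ := ∑ i, ε i * α i ^ 2

end Coordinates

/-- The warped product metric `π^* g_B + (f ∘ π)² σ^* g_F` on the product. -/
def warpedMetric {ι κ : Type*} (gB : (ι → ℝ) → Matrix ι ι ℝ) (f : (ι → ℝ) → ℝ)
    (gF : (κ → ℝ) → Matrix κ κ ℝ) (x : ι ⊕ κ → ℝ) : Matrix (ι ⊕ κ) (ι ⊕ κ) ℝ :=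
  Matrix.fromBlocks (gB (x ∘ Sum.inl)) 0 0 (f (x ∘ Sum.inl) ^ 2 • gF (x ∘ Sum.inr))

/-- The warped product of the base `({ξ ∈ I}, φ(ξ)⁻² g₀)` and the fiber `({ζ ∈ J}, τ(ζ)⁻² g₀)`
with warping function `f(ξ)`, where `ξ = ∑ αᵢ xᵢ` and `ζ = ∑ βⱼ yⱼ`, is a steady gradient
Ricci-harmonic soliton with potential `h(ξ)` and map `u(ζ)`, and its fiber is steady
harmonic-Einstein. -/
def IsSteadyWithSteadyFiber {n m : ℕ} (ε α : Fin n → ℝ) (δ β : Fin m → ℝ) (θ : ℝ)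
    (I J : Set ℝ) (φ f h τ u : ℝ → ℝ) : Prop :=
  IsGRHS {x : Fin n ⊕ Fin m → ℝ | lin α (x ∘ Sum.inl) ∈ I ∧ lin β (x ∘ Sum.inr) ∈ J}
      (warpedMetric (conformalMetric ε fun p => φ (lin α p)) (fun p => f (lin α p))
        (conformalMetric δ fun q => τ (lin β q)))
      (fun x => h (lin α (x ∘ Sum.inl))) (fun x => u (lin β (x ∘ Sum.inr))) θ 0 ∧
    IsHarmonicEinstein {q : Fin m → ℝ | lin β q ∈ J}
      (conformalMetric δ fun q => τ (lin β q)) (fun q => u (lin β q)) θ 0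

/-- `s` is not constant on `I`. -/
def NonConstOn (s : ℝ → ℝ) (I : Set ℝ) : Prop := ∃ x ∈ I, ∃ y ∈ I, s x ≠ s y

/-- The signed power `sgn(x) |x|^p`; it is the ordinary power for `x > 0`. -/
def signedPow (x p : ℝ) : ℝ := Real.sign x * |x| ^ p

/-- The base functions when `‖α‖² = 0`: `h` is given by two integrations from `φ` and `f`. -/
def BaseNull (n m : ℕ) (I : Set ℝ) (ξ₀ : ℝ) (φ f h : ℝ → ℝ) : Prop :=
  ∃ c₁ c₂ : ℝ, ∀ ξ ∈ I,
    h ξ = (∫ s in ξ₀..ξ, (φ s ^ 2)⁻¹ *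
      ((∫ r in ξ₀..s, ((m : ℝ) * (deriv (deriv f) r / f r) * φ r ^ 2
          + 2 * m * φ r * deriv φ r * (deriv f r / f r)
          - ((n : ℝ) - 2) * φ r * deriv (deriv φ) r)) + c₁)) + c₂

/-- The fiber functions when `‖β‖² = 0`: `u` is an integral of `± √((m-2)/θ · τ''/τ)`, where the
radicand is nonnegative and the sign is chosen pointwise so that the integrand is continuous. -/
def FiberNull (m : ℕ) (θ : ℝ) (J : Set ℝ) (ζ₀ : ℝ) (τ u : ℝ → ℝ) : Prop :=
  (∀ s ∈ J, 0 ≤ deriv (deriv τ) s / τ s) ∧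
  ∃ (σ : ℝ → ℝ) (c₃ : ℝ), (∀ s ∈ J, σ s = 1 ∨ σ s = -1) ∧
    ContinuousOn (fun s => σ s * √(((m : ℝ) - 2) / θ * (deriv (deriv τ) s / τ s))) J ∧
    ∀ ζ ∈ J, u ζ =
      (∫ s in ζ₀..ζ, σ s * √(((m : ℝ) - 2) / θ * (deriv (deriv τ) s / τ s))) + c₃

/-- The fiber functions when `‖β‖² = 1`. -/
def FiberUnit (m : ℕ) (θ : ℝ) (J : Set ℝ) (τ u : ℝ → ℝ) : Prop :=
  ∃ c₁ c₂ c₃ σ : ℝ, 0 < c₂ ∧ (σ = 1 ∨ σ = -1) ∧ ∀ ζ ∈ J,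
    ((m : ℝ) - 2) * ζ + c₁ ≠ 0 ∧
    τ ζ = c₂ * |((m : ℝ) - 2) * ζ + c₁| ^ (1 / (2 - (m : ℝ))) ∧
    u ζ = c₃ + σ * (√(2 - 3 * (m : ℝ) + (m : ℝ) ^ 2) * (((m : ℝ) - 2) * ζ + c₁) *
      Real.log |((m : ℝ) - 2) * ζ + c₁| /
        (((m : ℝ) - 2) * √(θ * (((m : ℝ) - 2) * ζ + c₁) ^ 2)))

/-- The discriminant root `√(m + k²(n-1))`. -/
def rootD (n m : ℕ) (k : ℝ) : ℝ := √((m : ℝ) + k ^ 2 * ((n : ℝ) - 1))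

/-- The power law family with exponent constant `N = N₊` or `N = N₋`. -/
def BasePower (n m : ℕ) (k : ℝ) (I : Set ℝ) (φ f h : ℝ → ℝ) : Prop :=
  ∃ N c₄ c₅ c₇ b : ℝ, (N = -k + rootD n m k ∨ N = -k - rootD n m k) ∧ 0 < c₄ ∧ 0 < c₅ ∧
    ∀ ξ ∈ I, N * ξ + b ≠ 0 ∧
      φ ξ = c₄ / |N * ξ + b| ^ (k / N) ∧
      f ξ = c₅ / |N * ξ + b| ^ (1 / N) ∧
      h ξ = -(((m : ℝ) - ((n : ℝ) - 2) * k + N) / N) * Real.log |N * ξ + b| + c₇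

/-- The family obtained by integrating the system in the auxiliary function `z`. -/
def BaseSystem (n m : ℕ) (k : ℝ) (z : ℝ → ℝ) (I : Set ℝ) (φ f h : ℝ → ℝ) : Prop :=
  ∃ (a c₆ : ℝ) (ψ : ℝ → ℝ), a = k / rootD n m k ∧
    ∀ ξ ∈ I,
      deriv φ ξ / φ ξ = k * (deriv f ξ / f ξ) ∧
      deriv f ξ / f ξ = ψ ξ ∧
      deriv h ξ = (z ξ + m - k * ((n : ℝ) - 2)) * ψ ξ ∧
      z ξ + k - rootD n m k ≠ 0 ∧ z ξ + k + rootD n m k ≠ 0 ∧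
      ψ ξ = c₆ * |z ξ + k - rootD n m k| ^ ((a - 1) / 2)
        * |z ξ + k + rootD n m k| ^ ((-a - 1) / 2) ∧
      deriv z ξ = -c₆ * signedPow (z ξ + k - rootD n m k) ((a + 1) / 2)
        * signedPow (z ξ + k + rootD n m k) ((-a + 1) / 2)

/-- The base functions when `‖α‖² = 1`: there are a constant `k` and a smooth function `z` with
`φ'/φ = k f'/f` and `h' + [(n-2)k - m] f'/f = z f'/f`; if `z` is a nonzero constant the functions
are power laws, if `z` is not constant they are obtained from the system in `z`. -/
def BaseUnit (n m : ℕ) (I : Set ℝ) (φ f h : ℝ → ℝ) : Prop :=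
  ∃ (k : ℝ) (z : ℝ → ℝ), ContDiffOn ℝ ∞ z I ∧
    (∀ ξ ∈ I, deriv φ ξ / φ ξ = k * (deriv f ξ / f ξ) ∧
      deriv h ξ + (((n : ℝ) - 2) * k - m) * (deriv f ξ / f ξ) = z ξ * (deriv f ξ / f ξ)) ∧
    (((∃ z₀ : ℝ, z₀ ≠ 0 ∧ ∀ ξ ∈ I, z ξ = z₀) ∧ BasePower n m k I φ f h) ∨
      (NonConstOn z I ∧ BaseSystem n m k z I φ f h))

end RicciHarmonic

end

open RicciHarmonic

/-!
The Ricci tensor, the Hessian and the Laplacian of a warped product split into a base block, a fiber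
block and a vanishing mixed block, so the soliton equations with steady harmonic-Einstein fiber are
tensor equations on the base together with those of the fiber. For a conformally flat metric
`φ⁻² g₀` with `φ` a function of `ξ = ∑ αᵢ xᵢ`, a tensor equation takes the form
`A αᵢ αⱼ + B ‖α‖² εᵢ δᵢⱼ = 0` with `A`, `B` functions of `ξ`. In dimension at least two this means
`A = 0` and `B ‖α‖² = 0`, since a tensor of rank one is never a nondegenerate diagonal one.

When `‖α‖² = 0`, what remains on the base is linear in `h'` with integrating factor `φ²`. When
`‖α‖² = 1`, both `φ'/φ` and `f'/f` solve `y' = p y` with the same coefficient `p`, hence `φ'/φ` is a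
constant multiple `k` of `f'/f`; the rest is the planar system `y' = z y²`,
`z' = -y (z + k - D) (z + k + D)` with `y = f'/f` and `D² = m + k² (n - 1)`. By uniqueness for
linear equations either `z` is one of the two constants `-k ± D`, which gives the power laws, or `z`
avoids both, and then `|z + k - D| ^ ((a - 1) / 2) * |z + k + D| ^ ((-a - 1) / 2)` with `a = k / D`
solves the same linear equation as `y`.

On the fiber, `‖β‖² = 0` leaves one equation for `u'²`, and for `‖β‖² = 1` the derivative `u'` is a
constant multiple of `τ'/τ`, which solves a Riccati equation.
-/

noncomputable section

namespace RicciHarmonic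

section PartialDerivatives

section Algebra

variable {ι : Type*} [DecidableEq ι] {F G : (ι → ℝ) → ℝ} {U : Set (ι → ℝ)} {x : ι → ℝ}

theorem pd_congr (hU : IsOpen U) (hx : x ∈ U) (h : ∀ y ∈ U, F y = G y) (i : ι) :
    pd i F x = pd i G x := by
  unfold pd
  rw [(Filter.eventuallyEq_of_mem (hU.mem_nhds hx) h).fderiv_eq]

theorem pd_const (i : ι) (c : ℝ) (x : ι → ℝ) : pd i (fun _ => c) x = 0 := by
  simp [pd]

variable [Finite ι]

theorem pd_sub (hF : DifferentiableAt ℝ F x) (hG : DifferentiableAt ℝ G x) (i : ι) :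
    pd i (fun y => F y - G y) x = pd i F x - pd i G x := by
  cases nonempty_fintype ι
  simp [pd, fderiv_fun_sub hF hG]

theorem pd_mul (hF : DifferentiableAt ℝ F x) (hG : DifferentiableAt ℝ G x) (i : ι) :
    pd i (fun y => F y * G y) x = pd i F x * G x + F x * pd i G x := by
  cases nonempty_fintype ι
  simp only [pd, fderiv_fun_mul hF hG, add_apply, smul_apply, smul_eq_mul]
  ring

theorem pd_neg (F : (ι → ℝ) → ℝ) (i : ι) (x : ι → ℝ) :
    pd i (fun y => -F y) x = -pd i F x := by
  cases nonempty_fintype ι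
  simp [pd, fderiv_fun_neg]

theorem pd_const_mul (hF : DifferentiableAt ℝ F x) (c : ℝ) (i : ι) :
    pd i (fun y => c * F y) x = c * pd i F x := by
  cases nonempty_fintype ι
  simp [pd, fderiv_const_mul hF]

theorem pd_comp {s : ℝ → ℝ} (hs : DifferentiableAt ℝ s (F x)) (hF : DifferentiableAt ℝ F x)
    (i : ι) : pd i (fun y => s (F y)) x = deriv s (F x) * pd i F x := by
  cases nonempty_fintype ι
  have hsF := hs.hasDerivAt.comp_hasFDerivAt x hF.hasFDerivAt
  unfold pd
  exact DFunLike.congr_fun hsF.fderiv (Pi.single i 1)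

end Algebra

section Smooth

variable {ι : Type*} [Fintype ι] [DecidableEq ι] {F : (ι → ℝ) → ℝ} {U : Set (ι → ℝ)}
  {x : ι → ℝ}

theorem contDiffOn_pd (hU : IsOpen U) (hF : ContDiffOn ℝ ∞ F U) (i : ι) :
    ContDiffOn ℝ ∞ (pd i F) U :=
  (hF.fderiv_of_isOpen hU (by simp)).clm_apply contDiffOn_const

theorem pd_comm (hU : IsOpen U) (hF : ContDiffOn ℝ ∞ F U) (hx : x ∈ U) (i j : ι) :
    pd i (pd j F) x = pd j (pd i F) x := by
  have hd : DifferentiableAt ℝ (fderiv ℝ F) x :=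
    ((hF.fderiv_of_isOpen hU (m := ∞) (by simp)).differentiableOn (by simp)).differentiableAt
      (hU.mem_nhds hx)
  have h : ∀ a b, pd a (pd b F) x = fderiv ℝ (fderiv ℝ F) x (Pi.single a 1) (Pi.single b 1) := by
    intro a b
    change fderiv ℝ (fun y => fderiv ℝ F y (Pi.single b 1)) x (Pi.single a 1) = _
    rw [fderiv_clm_apply hd (differentiableAt_const _)]
    simp
  rw [h, h]
  exact (hF.contDiffAt (hU.mem_nhds hx)).isSymmSndFDerivAt (by simpa using ENat.LEInfty.out) _ _

end Smooth

section LogarithmicDerivatives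

variable {ι : Type*} [Fintype ι] {U : Set (ι → ℝ)} {F : (ι → ℝ) → ℝ} {x : ι → ℝ}

/-- `F` is a smooth function without zeros on the open set `U`; conformal factors and warping
functions are of this kind. -/
structure IsSmoothNonzeroOn {E : Type*} [NormedAddCommGroup E] [NormedSpace ℝ E] (U : Set E)
    (F : E → ℝ) : Prop where
  isOpen : IsOpen U
  smooth : ContDiffOn ℝ ∞ F U
  ne_zero : ∀ x ∈ U, F x ≠ 0

theorem IsSmoothNonzeroOn.differentiableAt {E : Type*} [NormedAddCommGroup E] [NormedSpace ℝ E]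
    {U : Set E} {F : E → ℝ} {x : E} (hF : IsSmoothNonzeroOn U F) (hx : x ∈ U) :
    DifferentiableAt ℝ F x :=
  (hF.smooth.differentiableOn (by simp)).differentiableAt (hF.isOpen.mem_nhds hx)

variable [DecidableEq ι]

/-- The logarithmic partial derivative `∂ᵢF / F`. -/
def logPd (i : ι) (F : (ι → ℝ) → ℝ) (x : ι → ℝ) : ℝ := pd i F x / F x

namespace IsSmoothNonzeroOn

theorem differentiableAt_logPd (hF : IsSmoothNonzeroOn U F) (hx : x ∈ U) (i : ι) :
    DifferentiableAt ℝ (logPd i F) x :=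
  (((contDiffOn_pd hF.isOpen hF.smooth i).div hF.smooth hF.ne_zero).differentiableOn
    (by simp)).differentiableAt (hF.isOpen.mem_nhds hx)

theorem pd_logPd (hF : IsSmoothNonzeroOn U F) (hx : x ∈ U) (i j : ι) :
    pd j (logPd i F) x = pd i (pd j F) x / F x - logPd i F x * logPd j F x := by
  have hFx := hF.ne_zero x hx
  have hprod : pd j (fun y => logPd i F y * F y) x = pd j (pd i F) x :=
    pd_congr hF.isOpen hx (fun y hy => div_mul_cancel₀ _ (hF.ne_zero y hy)) j
  rw [pd_mul (hF.differentiableAt_logPd hx i) (hF.differentiableAt hx)] at hprod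
  rw [pd_comm hF.isOpen hF.smooth hx i j, ← hprod]
  simp only [logPd]
  field_simp
  ring

theorem pd_logPd_comm (hF : IsSmoothNonzeroOn U F) (hx : x ∈ U) (i j : ι) :
    pd i (logPd j F) x = pd j (logPd i F) x := by
  rw [hF.pd_logPd hx, hF.pd_logPd hx, pd_comm hF.isOpen hF.smooth hx, mul_comm]

end IsSmoothNonzeroOn

end LogarithmicDerivatives

section Composition

variable {ι ν : Type*} [Finite ν] [DecidableEq ν]

theorem pd_comp_right [Finite ι] [DecidableEq ι] {e : ι → ν} (he : e.Injective)
    (F : (ι → ℝ) → ℝ) (i : ι) (x : ν → ℝ) :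
    pd (e i) (fun y => F (y ∘ e)) x = pd i F (x ∘ e) := by
  cases nonempty_fintype ι
  cases nonempty_fintype ν
  let L : (ν → ℝ) →L[ℝ] ι → ℝ := ContinuousLinearMap.pi fun i => .proj (e i)
  by_cases hF : DifferentiableAt ℝ F (x ∘ e)
  · have hL : HasFDerivAt (fun y => F (y ∘ e)) (fderiv ℝ F (x ∘ e) ∘L L) x :=
      HasFDerivAt.comp (f := L) x hF.hasFDerivAt L.hasFDerivAt
    unfold pd
    rw [hL.fderiv, ContinuousLinearMap.comp_apply]
    congr 1
    ext j
    simp [L, Pi.single_apply, he.eq_iff]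
  · have hFe : ¬DifferentiableAt ℝ (fun y => F (y ∘ e)) x := by
      intro h
      have hsection : DifferentiableAt ℝ (fun p => Function.extend e p x) (x ∘ e) := by
        refine differentiableAt_pi.2 fun j => ?_
        by_cases hj : ∃ i, e i = j
        · obtain ⟨i, rfl⟩ := hj
          simp only [he.extend_apply]
          fun_prop
        · simp [Function.extend_apply' _ _ _ hj]
      have hx : Function.extend e (x ∘ e) x = x := by
        funext j
        by_cases hj : ∃ i, e i = j
        · obtain ⟨i, rfl⟩ := hj
          simp [he.extend_apply]
        · simp [Function.extend_apply' _ _ _ hj]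
      have := DifferentiableAt.comp (x ∘ e) (hx.symm ▸ h) hsection
      exact hF (by simpa [Function.comp_def, he.extend_apply] using this)
    simp [pd, fderiv_zero_of_not_differentiableAt, hF, hFe]

theorem pd_comp_right_eq_zero {e : ι → ν} {a : ν} (ha : ∀ i, e i ≠ a) (F : (ι → ℝ) → ℝ)
    (x : ν → ℝ) : pd a (fun y => F (y ∘ e)) x = 0 := by
  cases nonempty_fintype ν
  by_cases h : DifferentiableAt ℝ (fun y => F (y ∘ e)) x
  · have hline : ∀ t : ℝ, (x + t • Pi.single a 1) ∘ e = x ∘ e := fun t => by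
      funext i
      simp [ha i]
    unfold pd
    rw [← h.lineDeriv_eq_fderiv, lineDeriv]
    simp [hline]
  · simp [pd, fderiv_zero_of_not_differentiableAt h]

end Composition

end PartialDerivatives

section Metrics

variable {ι : Type*} [Fintype ι] [DecidableEq ι] {U : Set (ι → ℝ)}
  {g : (ι → ℝ) → Matrix ι ι ℝ} {x : ι → ℝ}

theorem contDiffOn_det {A : (ι → ℝ) → Matrix ι ι ℝ}
    (hA : ∀ i j, ContDiffOn ℝ ∞ (fun x => A x i j) U) : ContDiffOn ℝ ∞ (fun x => (A x).det) U := by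
  simp only [Matrix.det_apply']
  exact ContDiffOn.sum fun σ _ => contDiffOn_const.mul (contDiffOn_prod fun i _ => hA _ _)

/-- The gradient `(∇F)ᵏ = gᵏˡ ∂ₗF`. -/
def grad (g : (ι → ℝ) → Matrix ι ι ℝ) (F : (ι → ℝ) → ℝ) (k : ι) (x : ι → ℝ) : ℝ :=
  ∑ l, (g x)⁻¹ k l * pd l F x

/-- The divergence `∂ₖXᵏ + Γᵏₖₗ Xˡ` of a vector field. -/
def divergence (g : (ι → ℝ) → Matrix ι ι ℝ) (X : ι → (ι → ℝ) → ℝ) (x : ι → ℝ) : ℝ :=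
  ∑ k, pd k (X k) x + ∑ k, ∑ l, christoffel g k k l x * X l x

theorem sum_grad_mul_pd (g : (ι → ℝ) → Matrix ι ι ℝ) (F G : (ι → ℝ) → ℝ) (x : ι → ℝ) :
    ∑ k, grad g G k x * pd k F x = gradInner g F G x := by
  simp only [grad, gradInner, Finset.sum_mul]
  exact Finset.sum_congr rfl fun k _ => Finset.sum_congr rfl fun l _ => by ring

namespace IsMetricOn

theorem differentiableAt (hg : IsMetricOn U g) (hx : x ∈ U) (i j : ι) :
    DifferentiableAt ℝ (fun y => g y i j) x :=
  ((hg.smooth i j).differentiableOn (by simp)).differentiableAt (hg.isOpen.mem_nhds hx)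

theorem inv_mul_cancel (hg : IsMetricOn U g) (hx : x ∈ U) : (g x)⁻¹ * g x = 1 :=
  Matrix.nonsing_inv_mul _ (hg.nondegenerate x hx).isUnit

theorem mul_inv_cancel (hg : IsMetricOn U g) (hx : x ∈ U) : g x * (g x)⁻¹ = 1 :=
  Matrix.mul_nonsing_inv _ (hg.nondegenerate x hx).isUnit

theorem contDiffOn_inv (hg : IsMetricOn U g) (i j : ι) :
    ContDiffOn ℝ ∞ (fun x => (g x)⁻¹ i j) U := by
  have hadj : ContDiffOn ℝ ∞ (fun x => (g x).adjugate i j) U := by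
    simp only [Matrix.adjugate_apply]
    refine contDiffOn_det fun a b => ?_
    by_cases h : a = j
    · subst h
      simpa using contDiffOn_const
    · simpa [Matrix.updateRow_ne h] using hg.smooth a b
  simp only [Matrix.inv_def, Ring.inverse_eq_inv, Matrix.smul_apply, smul_eq_mul]
  exact ((contDiffOn_det hg.smooth).inv hg.nondegenerate).mul hadj

theorem contDiffOn_grad (hg : IsMetricOn U g) {F : (ι → ℝ) → ℝ} (hF : ContDiffOn ℝ ∞ F U) (k : ι) :
    ContDiffOn ℝ ∞ (grad g F k) U :=
  ContDiffOn.sum fun l _ => (hg.contDiffOn_inv k l).mul (contDiffOn_pd hg.isOpen hF l)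

theorem christoffel_comm (hg : IsMetricOn U g) (hx : x ∈ U) (k i j : ι) :
    christoffel g k i j x = christoffel g k j i x := by
  unfold christoffel
  congr 1
  refine Finset.sum_congr rfl fun l _ => ?_
  rw [pd_congr hg.isOpen hx (fun y hy => (hg.symm y hy).apply j i) l]
  ring

end IsMetricOn

end Metrics

section ProductCoordinates

variable {ι κ : Type*} {UB : Set (ι → ℝ)} {UF : Set (κ → ℝ)} {F : (ι → ℝ) → ℝ} {G : (κ → ℝ) → ℝ}
  {x : ι ⊕ κ → ℝ}

/-- The product of a region of the base and a region of the fiber. -/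
def productRegion (UB : Set (ι → ℝ)) (UF : Set (κ → ℝ)) : Set (ι ⊕ κ → ℝ) :=
  {x | x ∘ Sum.inl ∈ UB ∧ x ∘ Sum.inr ∈ UF}

theorem isOpen_productRegion (hB : IsOpen UB) (hF : IsOpen UF) :
    IsOpen (productRegion UB UF) :=
  (hB.preimage (by fun_prop)).inter (hF.preimage (by fun_prop))

variable [Fintype ι] [Fintype κ]

theorem contDiffOn_comp_inl (hF : ContDiffOn ℝ ∞ F UB) :
    ContDiffOn ℝ ∞ (fun y : ι ⊕ κ → ℝ => F (y ∘ Sum.inl)) (productRegion UB UF) :=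
  hF.comp (contDiff_pi.2 fun i => contDiff_apply ℝ ℝ (Sum.inl i)).contDiffOn fun _ hy => hy.1

theorem contDiffOn_comp_inr (hG : ContDiffOn ℝ ∞ G UF) :
    ContDiffOn ℝ ∞ (fun y : ι ⊕ κ → ℝ => G (y ∘ Sum.inr)) (productRegion UB UF) :=
  hG.comp (contDiff_pi.2 fun a => contDiff_apply ℝ ℝ (Sum.inr a)).contDiffOn fun _ hy => hy.2

end ProductCoordinates

section ProductDerivatives

variable {ι κ : Type*} [Finite ι] [Finite κ]
  {F : (ι → ℝ) → ℝ} {G : (κ → ℝ) → ℝ} {x : ι ⊕ κ → ℝ}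

theorem differentiableAt_comp_inl (hF : DifferentiableAt ℝ F (x ∘ Sum.inl)) :
    DifferentiableAt ℝ (fun y : ι ⊕ κ → ℝ => F (y ∘ Sum.inl)) x := by
  cases nonempty_fintype ι
  cases nonempty_fintype κ
  exact hF.comp x (differentiableAt_pi.2 fun i => differentiableAt_apply (Sum.inl i) x)

theorem differentiableAt_comp_inr (hG : DifferentiableAt ℝ G (x ∘ Sum.inr)) :
    DifferentiableAt ℝ (fun y : ι ⊕ κ → ℝ => G (y ∘ Sum.inr)) x := by
  cases nonempty_fintype ι
  cases nonempty_fintype κ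
  exact hG.comp x (differentiableAt_pi.2 fun a => differentiableAt_apply (Sum.inr a) x)

variable [DecidableEq ι] [DecidableEq κ]

theorem pd_inl_comp_inl (F : (ι → ℝ) → ℝ) (i : ι) :
    pd (Sum.inl i) (fun y : ι ⊕ κ → ℝ => F (y ∘ Sum.inl)) = fun y => pd i F (y ∘ Sum.inl) :=
  funext (pd_comp_right Sum.inl_injective F i)

theorem pd_inr_comp_inr (G : (κ → ℝ) → ℝ) (a : κ) :
    pd (Sum.inr a) (fun y : ι ⊕ κ → ℝ => G (y ∘ Sum.inr)) = fun y => pd a G (y ∘ Sum.inr) :=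
  funext (pd_comp_right Sum.inr_injective G a)

theorem pd_inr_comp_inl (F : (ι → ℝ) → ℝ) (a : κ) :
    pd (Sum.inr a) (fun y : ι ⊕ κ → ℝ => F (y ∘ Sum.inl)) = fun _ => 0 :=
  funext (pd_comp_right_eq_zero (fun _ => Sum.inl_ne_inr) F)

theorem pd_inl_comp_inr (G : (κ → ℝ) → ℝ) (i : ι) :
    pd (Sum.inl i) (fun y : ι ⊕ κ → ℝ => G (y ∘ Sum.inr)) = fun _ => 0 :=
  funext (pd_comp_right_eq_zero (fun _ => Sum.inr_ne_inl) G)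

theorem pd_inl_mul (hF : DifferentiableAt ℝ F (x ∘ Sum.inl))
    (hG : DifferentiableAt ℝ G (x ∘ Sum.inr)) (i : ι) :
    pd (Sum.inl i) (fun y => F (y ∘ Sum.inl) * G (y ∘ Sum.inr)) x =
      pd i F (x ∘ Sum.inl) * G (x ∘ Sum.inr) := by
  rw [pd_mul (differentiableAt_comp_inl hF) (differentiableAt_comp_inr hG), pd_inl_comp_inl,
    pd_inl_comp_inr, mul_zero, add_zero]

theorem pd_inr_mul (hF : DifferentiableAt ℝ F (x ∘ Sum.inl))
    (hG : DifferentiableAt ℝ G (x ∘ Sum.inr)) (a : κ) :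
    pd (Sum.inr a) (fun y => F (y ∘ Sum.inl) * G (y ∘ Sum.inr)) x =
      F (x ∘ Sum.inl) * pd a G (x ∘ Sum.inr) := by
  rw [pd_mul (differentiableAt_comp_inl hF) (differentiableAt_comp_inr hG), pd_inr_comp_inl,
    pd_inr_comp_inr, zero_mul, zero_add]

end ProductDerivatives

section WarpedProduct

variable {ι κ : Type*} [Fintype ι] [DecidableEq ι] [Fintype κ] [DecidableEq κ]
  {UB : Set (ι → ℝ)} {UF : Set (κ → ℝ)} {gB : (ι → ℝ) → Matrix ι ι ℝ}
  {gF : (κ → ℝ) → Matrix κ κ ℝ} {f : (ι → ℝ) → ℝ} {x : ι ⊕ κ → ℝ}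

/-- The data of a warped product: metrics on a region of the base and on a region of the fiber,
and a smooth nowhere vanishing warping function on the base. -/
structure IsWarpedProduct (UB : Set (ι → ℝ)) (UF : Set (κ → ℝ)) (gB : (ι → ℝ) → Matrix ι ι ℝ)
    (gF : (κ → ℝ) → Matrix κ κ ℝ) (f : (ι → ℝ) → ℝ) : Prop where
  base : IsMetricOn UB gB
  fiber : IsMetricOn UF gF
  warping : IsSmoothNonzeroOn UB f

namespace IsWarpedProduct

theorem isOpen (H : IsWarpedProduct UB UF gB gF f) : IsOpen (productRegion UB UF) :=
  isOpen_productRegion H.base.isOpen H.fiber.isOpen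

theorem inv_warpedMetric (H : IsWarpedProduct UB UF gB gF f) (hx : x ∈ productRegion UB UF) :
    (warpedMetric gB f gF x)⁻¹ = Matrix.fromBlocks (gB (x ∘ Sum.inl))⁻¹ 0 0
      ((f (x ∘ Sum.inl) ^ 2)⁻¹ • (gF (x ∘ Sum.inr))⁻¹) := by
  have hf := H.warping.ne_zero _ hx.1
  apply Matrix.inv_eq_right_inv
  simp [warpedMetric, Matrix.fromBlocks_multiply, H.base.mul_inv_cancel hx.1,
    H.fiber.mul_inv_cancel hx.2, smul_smul, hf]

theorem isMetricOn (H : IsWarpedProduct UB UF gB gF f) :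
    IsMetricOn (productRegion UB UF) (warpedMetric gB f gF) where
  isOpen := H.isOpen
  smooth := by
    rintro (i | a) (j | b)
    · exact contDiffOn_comp_inl (H.base.smooth i j)
    · exact contDiffOn_const
    · exact contDiffOn_const
    · exact (contDiffOn_comp_inl (H.warping.smooth.pow 2)).mul
        (contDiffOn_comp_inr (H.fiber.smooth a b))
  symm x hx := Matrix.IsSymm.fromBlocks (H.base.symm _ hx.1) Matrix.transpose_zero
    ((H.fiber.symm _ hx.2).smul _)
  nondegenerate x hx := by
    simp [warpedMetric, H.warping.ne_zero _ hx.1, H.base.nondegenerate _ hx.1,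
      H.fiber.nondegenerate _ hx.2]

theorem pd_inl_warpedMetric (H : IsWarpedProduct UB UF gB gF f) (hx : x ∈ productRegion UB UF)
    (i : ι) (a b : κ) :
    pd (Sum.inl i) (fun y => warpedMetric gB f gF y (Sum.inr a) (Sum.inr b)) x =
      2 * f (x ∘ Sum.inl) * pd i f (x ∘ Sum.inl) * gF (x ∘ Sum.inr) a b := by
  have hf := H.warping.differentiableAt hx.1
  have hsq : pd i (fun p => f p ^ 2) (x ∘ Sum.inl) =
      2 * f (x ∘ Sum.inl) * pd i f (x ∘ Sum.inl) := by
    simp only [pow_two]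
    rw [pd_mul hf hf]
    ring
  rw [← hsq]
  exact pd_inl_mul (hf.pow 2) (H.fiber.differentiableAt hx.2 a b) i

theorem pd_inr_warpedMetric (H : IsWarpedProduct UB UF gB gF f) (hx : x ∈ productRegion UB UF)
    (c a b : κ) :
    pd (Sum.inr c) (fun y => warpedMetric gB f gF y (Sum.inr a) (Sum.inr b)) x =
      f (x ∘ Sum.inl) ^ 2 * pd c (fun q => gF q a b) (x ∘ Sum.inr) :=
  pd_inr_mul ((H.warping.differentiableAt hx.1).pow 2) (H.fiber.differentiableAt hx.2 a b) c

theorem christoffel_inl_inl_inl (H : IsWarpedProduct UB UF gB gF f)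
    (hx : x ∈ productRegion UB UF) (k i j : ι) :
    christoffel (warpedMetric gB f gF) (Sum.inl k) (Sum.inl i) (Sum.inl j) x =
      christoffel gB k i j (x ∘ Sum.inl) := by
  have hpd : ∀ i j l : ι,
      pd (Sum.inl i) (fun y => warpedMetric gB f gF y (Sum.inl j) (Sum.inl l)) x =
        pd i (fun p => gB p j l) (x ∘ Sum.inl) :=
    fun i j l => congrFun (pd_inl_comp_inl (fun p => gB p j l) i) x
  simp [christoffel, H.inv_warpedMetric hx, hpd]

theorem christoffel_inr_inl_inl (H : IsWarpedProduct UB UF gB gF f)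
    (hx : x ∈ productRegion UB UF) (a : κ) (i j : ι) :
    christoffel (warpedMetric gB f gF) (Sum.inr a) (Sum.inl i) (Sum.inl j) x = 0 := by
  have hpd : ∀ b, pd (Sum.inr b) (fun y => warpedMetric gB f gF y (Sum.inl i) (Sum.inl j)) x = 0 :=
    fun b => congrFun (pd_inr_comp_inl (fun p => gB p i j) b) x
  simp only [christoffel, H.inv_warpedMetric hx, Fintype.sum_sum_type, hpd]
  simp [warpedMetric, pd_const]

theorem christoffel_inl_inl_inr (H : IsWarpedProduct UB UF gB gF f)
    (hx : x ∈ productRegion UB UF) (k i : ι) (a : κ) :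
    christoffel (warpedMetric gB f gF) (Sum.inl k) (Sum.inl i) (Sum.inr a) x = 0 := by
  have hpd : ∀ l, pd (Sum.inr a) (fun y => warpedMetric gB f gF y (Sum.inl i) (Sum.inl l)) x = 0 :=
    fun l => congrFun (pd_inr_comp_inl (fun p => gB p i l) a) x
  simp only [christoffel, H.inv_warpedMetric hx, Fintype.sum_sum_type, hpd]
  simp [warpedMetric, pd_const]

theorem christoffel_inl_inr_inl (H : IsWarpedProduct UB UF gB gF f)
    (hx : x ∈ productRegion UB UF) (k i : ι) (a : κ) :
    christoffel (warpedMetric gB f gF) (Sum.inl k) (Sum.inr a) (Sum.inl i) x = 0 := by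
  rw [H.isMetricOn.christoffel_comm hx, H.christoffel_inl_inl_inr hx]

theorem christoffel_inr_inl_inr (H : IsWarpedProduct UB UF gB gF f)
    (hx : x ∈ productRegion UB UF) (a b : κ) (i : ι) :
    christoffel (warpedMetric gB f gF) (Sum.inr a) (Sum.inl i) (Sum.inr b) x =
      logPd i f (x ∘ Sum.inl) * (1 : Matrix κ κ ℝ) a b := by
  have hf := H.warping.ne_zero _ hx.1
  have hmix : ∀ c, pd (Sum.inr b) (fun y => warpedMetric gB f gF y (Sum.inl i) (Sum.inr c)) x = 0 :=
    fun _ => pd_const _ 0 x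
  have hmix' : ∀ c,
      pd (Sum.inr c) (fun y => warpedMetric gB f gF y (Sum.inl i) (Sum.inr b)) x = 0 :=
    fun _ => pd_const _ 0 x
  rw [← H.fiber.inv_mul_cancel hx.2]
  simp only [christoffel, H.inv_warpedMetric hx, Fintype.sum_sum_type, hmix, hmix',
    H.pd_inl_warpedMetric hx, Matrix.mul_apply, Matrix.fromBlocks_apply₂₁,
    Matrix.fromBlocks_apply₂₂, Matrix.zero_apply, zero_mul, Finset.sum_const_zero, zero_add,
    Matrix.smul_apply, smul_eq_mul, add_zero, sub_zero, Finset.mul_sum]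
  refine Finset.sum_congr rfl fun c _ => ?_
  rw [(H.fiber.symm _ hx.2).apply, logPd]
  field_simp

theorem christoffel_inr_inr_inl (H : IsWarpedProduct UB UF gB gF f)
    (hx : x ∈ productRegion UB UF) (a b : κ) (i : ι) :
    christoffel (warpedMetric gB f gF) (Sum.inr a) (Sum.inr b) (Sum.inl i) x =
      logPd i f (x ∘ Sum.inl) * (1 : Matrix κ κ ℝ) a b := by
  rw [H.isMetricOn.christoffel_comm hx, H.christoffel_inr_inl_inr hx]

theorem christoffel_inl_inr_inr (H : IsWarpedProduct UB UF gB gF f)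
    (hx : x ∈ productRegion UB UF) (k : ι) (a b : κ) :
    christoffel (warpedMetric gB f gF) (Sum.inl k) (Sum.inr a) (Sum.inr b) x =
      -(f (x ∘ Sum.inl) * grad gB f k (x ∘ Sum.inl) * gF (x ∘ Sum.inr) a b) := by
  have hmix : ∀ c d l,
      pd (Sum.inr c) (fun y => warpedMetric gB f gF y (Sum.inr d) (Sum.inl l)) x = 0 :=
    fun _ _ _ => pd_const _ 0 x
  simp only [christoffel, grad, H.inv_warpedMetric hx, Fintype.sum_sum_type, hmix,
    H.pd_inl_warpedMetric hx, Matrix.fromBlocks_apply₁₁,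
    Matrix.fromBlocks_apply₁₂, Matrix.zero_apply, zero_mul, Finset.sum_const_zero, add_zero,
    Finset.mul_sum, Finset.sum_mul, ← Finset.sum_neg_distrib]
  exact Finset.sum_congr rfl fun l _ => by ring

theorem christoffel_inr_inr_inr (H : IsWarpedProduct UB UF gB gF f)
    (hx : x ∈ productRegion UB UF) (a b c : κ) :
    christoffel (warpedMetric gB f gF) (Sum.inr a) (Sum.inr b) (Sum.inr c) x =
      christoffel gF a b c (x ∘ Sum.inr) := by
  have hf := H.warping.ne_zero _ hx.1
  simp only [christoffel, H.inv_warpedMetric hx, Fintype.sum_sum_type,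
    H.pd_inr_warpedMetric hx, Matrix.fromBlocks_apply₂₁,
    Matrix.fromBlocks_apply₂₂, Matrix.zero_apply, zero_mul, Finset.sum_const_zero, zero_add,
    Matrix.smul_apply, smul_eq_mul, Finset.mul_sum]
  exact Finset.sum_congr rfl fun d _ => by field_simp

end IsWarpedProduct

end WarpedProduct

theorem ricci_eq {ι : Type*} [Fintype ι] [DecidableEq ι] (g : (ι → ℝ) → Matrix ι ι ℝ) (i j : ι)
    (x : ι → ℝ) :
    ricci g i j x = ∑ k, pd k (christoffel g k i j) x - ∑ k, pd j (christoffel g k i k) x +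
      ∑ l, (∑ k, christoffel g k k l x) * christoffel g l i j x -
      ∑ k, ∑ l, christoffel g k j l x * christoffel g l i k x := by
  simp only [ricci, Finset.sum_sub_distrib, Finset.sum_mul]
  rw [Finset.sum_comm (f := fun k l => christoffel g k k l x * _)]
  ring

section WarpedProductCurvature

variable {ι κ : Type*} [Fintype ι] [DecidableEq ι] [Fintype κ] [DecidableEq κ]
  {UB : Set (ι → ℝ)} {UF : Set (κ → ℝ)} {gB : (ι → ℝ) → Matrix ι ι ℝ}
  {gF : (κ → ℝ) → Matrix κ κ ℝ} {f : (ι → ℝ) → ℝ} {x : ι ⊕ κ → ℝ}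

namespace IsWarpedProduct

theorem differentiableAt_mul_grad (H : IsWarpedProduct UB UF gB gF f) {p : ι → ℝ} (hp : p ∈ UB)
    (k : ι) : DifferentiableAt ℝ (fun q => f q * grad gB f k q) p :=
  ((H.warping.smooth.mul (H.base.contDiffOn_grad H.warping.smooth k)).differentiableOn
    (by simp)).differentiableAt (H.base.isOpen.mem_nhds hp)

theorem ricci_inl_inl (H : IsWarpedProduct UB UF gB gF f) (hx : x ∈ productRegion UB UF)
    (i j : ι) :
    ricci (warpedMetric gB f gF) (Sum.inl i) (Sum.inl j) x =
      ricci gB i j (x ∘ Sum.inl) -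
        Fintype.card κ / f (x ∘ Sum.inl) * hess gB f i j (x ∘ Sum.inl) := by
  have hbase : ∀ k i j l, pd (Sum.inl l)
      (christoffel (warpedMetric gB f gF) (Sum.inl k) (Sum.inl i) (Sum.inl j)) x =
        pd l (christoffel gB k i j) (x ∘ Sum.inl) := fun k i j l => by
    rw [pd_congr H.isOpen hx fun y hy => H.christoffel_inl_inl_inl hy k i j, pd_inl_comp_inl]
  have hfiber : ∀ a, pd (Sum.inr a)
      (christoffel (warpedMetric gB f gF) (Sum.inr a) (Sum.inl i) (Sum.inl j)) x = 0 := fun a => by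
    rw [pd_congr H.isOpen hx fun y hy => H.christoffel_inr_inl_inl hy a i j, pd_const]
  have htrace : ∀ a, pd (Sum.inl j)
      (christoffel (warpedMetric gB f gF) (Sum.inr a) (Sum.inl i) (Sum.inr a)) x =
        pd j (logPd i f) (x ∘ Sum.inl) := fun a => by
    rw [pd_congr H.isOpen hx fun y hy => H.christoffel_inr_inl_inr hy a a i]
    simp [pd_inl_comp_inl (logPd i f)]
  rw [ricci_eq, ricci_eq]
  simp only [Fintype.sum_sum_type, H.christoffel_inl_inl_inl hx,
    H.christoffel_inr_inl_inl hx, H.christoffel_inl_inl_inr hx, H.christoffel_inr_inl_inr hx,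
    H.christoffel_inr_inr_inl hx, hbase, hfiber, htrace, H.warping.pd_logPd hx.1, hess]
  have hcontract : ∑ l, Fintype.card κ * logPd l f (x ∘ Sum.inl) *
      christoffel gB l i j (x ∘ Sum.inl) = Fintype.card κ / f (x ∘ Sum.inl) *
        ∑ l, christoffel gB l i j (x ∘ Sum.inl) * pd l f (x ∘ Sum.inl) := by
    rw [Finset.mul_sum]
    exact Finset.sum_congr rfl fun l _ => by rw [logPd]; ring
  simp only [Finset.sum_const_zero, add_zero, Finset.sum_sub_distrib, Finset.sum_const,
    Finset.card_univ, nsmul_eq_mul, Matrix.one_apply_eq, mul_one, add_mul, Finset.sum_add_distrib,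
    hcontract, zero_add, mul_zero, Matrix.one_apply, mul_ite, ite_mul, zero_mul,
    Finset.sum_ite_eq', Finset.mem_univ, if_true]
  ring

theorem ricci_inl_inr (H : IsWarpedProduct UB UF gB gF f) (hx : x ∈ productRegion UB UF)
    (i : ι) (a : κ) :
    ricci (warpedMetric gB f gF) (Sum.inl i) (Sum.inr a) x = 0 := by
  have hbase : ∀ k, pd (Sum.inl k)
      (christoffel (warpedMetric gB f gF) (Sum.inl k) (Sum.inl i) (Sum.inr a)) x = 0 := fun k => by
    rw [pd_congr H.isOpen hx fun y hy => H.christoffel_inl_inl_inr hy k i a, pd_const]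
  have hbase' : ∀ k, pd (Sum.inr a)
      (christoffel (warpedMetric gB f gF) (Sum.inl k) (Sum.inl i) (Sum.inl k)) x = 0 := fun k => by
    rw [pd_congr H.isOpen hx fun y hy => H.christoffel_inl_inl_inl hy k i k, pd_inr_comp_inl]
  have hfiber : ∀ b c d, pd (Sum.inr c)
      (christoffel (warpedMetric gB f gF) (Sum.inr b) (Sum.inl i) (Sum.inr d)) x = 0 := by
    intro b c d
    rw [pd_congr H.isOpen hx fun y hy => H.christoffel_inr_inl_inr hy b d i]
    exact congrFun (pd_inr_comp_inl (fun p => logPd i f p * (1 : Matrix κ κ ℝ) b d) c) x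
  rw [ricci_eq]
  simp only [Fintype.sum_sum_type, H.christoffel_inl_inl_inl hx, H.christoffel_inr_inl_inl hx,
    H.christoffel_inl_inl_inr hx, H.christoffel_inr_inl_inr hx, H.christoffel_inr_inr_inl hx,
    H.christoffel_inr_inr_inr hx, H.christoffel_inl_inr_inl hx, hbase, hbase', hfiber]
  simp [Matrix.one_apply, Finset.sum_mul, H.fiber.christoffel_comm hx.2 _ a]

theorem ricci_inr_inl (H : IsWarpedProduct UB UF gB gF f) (hx : x ∈ productRegion UB UF)
    (a : κ) (i : ι) :
    ricci (warpedMetric gB f gF) (Sum.inr a) (Sum.inl i) x = 0 := by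
  have hbase : ∀ k l K, pd l
      (christoffel (warpedMetric gB f gF) (Sum.inl k) (Sum.inr a) (Sum.inl K)) x = 0 := by
    intro k l K
    rw [pd_congr H.isOpen hx fun y hy => H.christoffel_inl_inr_inl hy k K a, pd_const]
  have hfiber : ∀ b, pd (Sum.inr b)
      (christoffel (warpedMetric gB f gF) (Sum.inr b) (Sum.inr a) (Sum.inl i)) x = 0 := by
    intro b
    rw [pd_congr H.isOpen hx fun y hy => H.christoffel_inr_inr_inl hy b a i]
    exact congrFun (pd_inr_comp_inl (fun p => logPd i f p * (1 : Matrix κ κ ℝ) b a) b) x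
  have hfiber' : ∀ b, pd (Sum.inl i)
      (christoffel (warpedMetric gB f gF) (Sum.inr b) (Sum.inr a) (Sum.inr b)) x = 0 := fun b => by
    rw [pd_congr H.isOpen hx fun y hy => H.christoffel_inr_inr_inr hy b a b, pd_inl_comp_inr]
  rw [ricci_eq]
  simp only [Fintype.sum_sum_type, H.christoffel_inl_inl_inl hx, H.christoffel_inr_inl_inl hx,
    H.christoffel_inl_inl_inr hx, H.christoffel_inr_inl_inr hx, H.christoffel_inr_inr_inl hx,
    H.christoffel_inr_inr_inr hx, H.christoffel_inl_inr_inl hx, hbase, hfiber, hfiber']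
  simp [Matrix.one_apply, ← Finset.mul_sum, mul_comm,
    H.fiber.christoffel_comm hx.2 _ a]

theorem pd_christoffel_inl_inr_inr (H : IsWarpedProduct UB UF gB gF f)
    (hx : x ∈ productRegion UB UF) (k : ι) (a b : κ) :
    pd (Sum.inl k) (christoffel (warpedMetric gB f gF) (Sum.inl k) (Sum.inr a) (Sum.inr b)) x =
      -(pd k (fun p => f p * grad gB f k p) (x ∘ Sum.inl) * gF (x ∘ Sum.inr) a b) := by
  rw [pd_congr H.isOpen hx fun y hy => H.christoffel_inl_inr_inr hy k a b, pd_neg]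
  congr 1
  exact pd_inl_mul (H.differentiableAt_mul_grad hx.1 k) (H.fiber.differentiableAt hx.2 a b) k

theorem logPd_mul_mul_grad (H : IsWarpedProduct UB UF gB gF f) {p : ι → ℝ} (hp : p ∈ UB)
    (k : ι) (c : ℝ) :
    logPd k f p * (f p * grad gB f k p * c) = grad gB f k p * pd k f p * c := by
  have hf := H.warping.ne_zero p hp
  rw [logPd]
  field_simp

theorem ricci_inr_inr (H : IsWarpedProduct UB UF gB gF f) (hx : x ∈ productRegion UB UF)
    (a b : κ) :
    ricci (warpedMetric gB f gF) (Sum.inr a) (Sum.inr b) x =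
      ricci gF a b (x ∘ Sum.inr) - (divergence gB (fun k p => f p * grad gB f k p) (x ∘ Sum.inl) +
        (Fintype.card κ - 2) * gradInner gB f f (x ∘ Sum.inl)) * gF (x ∘ Sum.inr) a b := by
  have hbase : ∀ k, pd (Sum.inr b)
      (christoffel (warpedMetric gB f gF) (Sum.inl k) (Sum.inr a) (Sum.inl k)) x = 0 := fun k => by
    rw [pd_congr H.isOpen hx fun y hy => H.christoffel_inl_inr_inl hy k k a, pd_const]
  have hfiber : ∀ c d e, pd (Sum.inr e)
      (christoffel (warpedMetric gB f gF) (Sum.inr c) (Sum.inr a) (Sum.inr d)) x =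
        pd e (christoffel gF c a d) (x ∘ Sum.inr) := fun c d e => by
    rw [pd_congr H.isOpen hx fun y hy => H.christoffel_inr_inr_inr hy c a d, pd_inr_comp_inr]
  have hcancel := H.logPd_mul_mul_grad hx.1
  have hcancel' : ∀ k c, f (x ∘ Sum.inl) * grad gB f k (x ∘ Sum.inl) * c *
      logPd k f (x ∘ Sum.inl) =
        grad gB f k (x ∘ Sum.inl) * pd k f (x ∘ Sum.inl) * c := fun k c => by
    rw [mul_comm, hcancel]
  have htrace : ∑ l, (∑ k, christoffel gB k k l (x ∘ Sum.inl)) *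
      (f (x ∘ Sum.inl) * grad gB f l (x ∘ Sum.inl) * gF (x ∘ Sum.inr) a b) =
        (∑ l, ∑ k, christoffel gB k k l (x ∘ Sum.inl) *
          (f (x ∘ Sum.inl) * grad gB f l (x ∘ Sum.inl))) * gF (x ∘ Sum.inr) a b := by
    simp only [Finset.sum_mul, mul_assoc]
  have hgradient : ∑ l, (Fintype.card κ : ℝ) * logPd l f (x ∘ Sum.inl) *
      (f (x ∘ Sum.inl) * grad gB f l (x ∘ Sum.inl) * gF (x ∘ Sum.inr) a b) =
        Fintype.card κ * (∑ l, grad gB f l (x ∘ Sum.inl) * pd l f (x ∘ Sum.inl)) *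
          gF (x ∘ Sum.inr) a b := by
    simp only [mul_assoc (Fintype.card κ : ℝ), hcancel, ← Finset.sum_mul, ← Finset.mul_sum]
  rw [ricci_eq, ricci_eq, divergence, Finset.sum_comm (f := fun k l => christoffel gB k k l _ * _)]
  simp only [Fintype.sum_sum_type, H.christoffel_inl_inl_inl hx, H.christoffel_inl_inl_inr hx,
    H.christoffel_inr_inr_inl hx, H.christoffel_inr_inr_inr hx, H.christoffel_inl_inr_inl hx,
    H.christoffel_inl_inr_inr hx, H.pd_christoffel_inl_inr_inr hx, hbase, hfiber, ← sum_grad_mul_pd]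
  simp only [Matrix.one_apply, mul_ite, mul_one, mul_zero, ite_mul, zero_mul, Finset.mem_univ,
    Finset.sum_ite_eq', if_true, Finset.sum_const, Finset.card_univ, nsmul_eq_mul, add_mul,
    Finset.sum_add_distrib, zero_add, mul_neg, neg_mul, Finset.sum_neg_distrib, hcancel,
    hcancel', (H.fiber.symm _ hx.2).apply a b, ← Finset.sum_mul]
  rw [htrace, hgradient, Finset.sum_comm (f := fun c k => if c = b then _ else _)]
  simp only [Finset.sum_ite_eq', Finset.mem_univ, if_true, ← Finset.sum_mul]
  ring

end IsWarpedProduct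

end WarpedProductCurvature

section WarpedProductSolitons

variable {ι κ : Type*} [Fintype ι] [DecidableEq ι] [Fintype κ] [DecidableEq κ]
  {UB : Set (ι → ℝ)} {UF : Set (κ → ℝ)} {gB : (ι → ℝ) → Matrix ι ι ℝ}
  {gF : (κ → ℝ) → Matrix κ κ ℝ} {f h : (ι → ℝ) → ℝ} {u : (κ → ℝ) → ℝ} {x : ι ⊕ κ → ℝ} {θ : ℝ}

namespace IsWarpedProduct

theorem hess_comp_inl_inl_inl (H : IsWarpedProduct UB UF gB gF f)
    (hx : x ∈ productRegion UB UF) (h : (ι → ℝ) → ℝ) (i j : ι) :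
    hess (warpedMetric gB f gF) (fun y => h (y ∘ Sum.inl)) (Sum.inl i) (Sum.inl j) x =
      hess gB h i j (x ∘ Sum.inl) := by
  simp [hess, pd_inl_comp_inl, pd_inr_comp_inl,
    H.christoffel_inl_inl_inl hx]

theorem hess_comp_inl_inl_inr (H : IsWarpedProduct UB UF gB gF f)
    (hx : x ∈ productRegion UB UF) (h : (ι → ℝ) → ℝ) (i : ι) (a : κ) :
    hess (warpedMetric gB f gF) (fun y => h (y ∘ Sum.inl)) (Sum.inl i) (Sum.inr a) x = 0 := by
  simp [hess, pd_inr_comp_inl, pd_const, H.christoffel_inl_inl_inr hx]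

theorem hess_comp_inl_inr_inl (H : IsWarpedProduct UB UF gB gF f)
    (hx : x ∈ productRegion UB UF) (h : (ι → ℝ) → ℝ) (a : κ) (i : ι) :
    hess (warpedMetric gB f gF) (fun y => h (y ∘ Sum.inl)) (Sum.inr a) (Sum.inl i) x = 0 := by
  simp [hess, pd_inl_comp_inl, pd_inr_comp_inl,
    H.christoffel_inl_inr_inl hx]

theorem hess_comp_inl_inr_inr (H : IsWarpedProduct UB UF gB gF f)
    (hx : x ∈ productRegion UB UF) (h : (ι → ℝ) → ℝ) (a b : κ) :
    hess (warpedMetric gB f gF) (fun y => h (y ∘ Sum.inl)) (Sum.inr a) (Sum.inr b) x =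
      f (x ∘ Sum.inl) * gradInner gB h f (x ∘ Sum.inl) * gF (x ∘ Sum.inr) a b := by
  simp only [hess, pd_inl_comp_inl, pd_inr_comp_inl, pd_const, Fintype.sum_sum_type,
    H.christoffel_inl_inr_inr hx, mul_zero, Finset.sum_const_zero, add_zero, zero_sub,
    ← sum_grad_mul_pd, Finset.mul_sum, Finset.sum_mul, ← Finset.sum_neg_distrib]
  exact Finset.sum_congr rfl fun k _ => by ring

theorem tension_comp_inr (H : IsWarpedProduct UB UF gB gF f) (hx : x ∈ productRegion UB UF)
    (u : (κ → ℝ) → ℝ) :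
    tension (warpedMetric gB f gF) (fun y => u (y ∘ Sum.inr)) x =
      (f (x ∘ Sum.inl) ^ 2)⁻¹ * tension gF u (x ∘ Sum.inr) := by
  have hbase : ∀ i j,
      hess (warpedMetric gB f gF) (fun y => u (y ∘ Sum.inr)) (Sum.inl i) (Sum.inl j) x = 0 := by
    simp [hess, pd_inl_comp_inr, pd_const, H.christoffel_inr_inl_inl hx]
  have hfiber : ∀ a b,
      hess (warpedMetric gB f gF) (fun y => u (y ∘ Sum.inr)) (Sum.inr a) (Sum.inr b) x =
        hess gF u a b (x ∘ Sum.inr) := by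
    simp [hess, pd_inl_comp_inr, pd_inr_comp_inr,
      H.christoffel_inr_inr_inr hx]
  simp [tension, H.inv_warpedMetric hx, hbase, hfiber, Finset.mul_sum, mul_assoc]

theorem gradInner_comp_inr_comp_inl (H : IsWarpedProduct UB UF gB gF f)
    (hx : x ∈ productRegion UB UF) (u : (κ → ℝ) → ℝ) (h : (ι → ℝ) → ℝ) :
    gradInner (warpedMetric gB f gF) (fun y => u (y ∘ Sum.inr)) (fun y => h (y ∘ Sum.inl)) x =
      0 := by
  simp [gradInner, H.inv_warpedMetric hx, pd_inl_comp_inr, pd_inr_comp_inl]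

end IsWarpedProduct

/-- The soliton equations of a warped product with harmonic-Einstein fiber of constant `0`,
potential `h` on the base and map on the fiber, expressed on the base: the base components of the
equation, and the factor by which the metric of the fiber is multiplied in its fiber components. -/
def BaseSolitonEquations (gB : (ι → ℝ) → Matrix ι ι ℝ) (f h : (ι → ℝ) → ℝ) (m : ℝ)
    (p : ι → ℝ) : Prop :=
  (∀ i j, ricci gB i j p - m / f p * hess gB f i j p + hess gB h i j p = 0) ∧
    divergence gB (fun k q => f q * grad gB f k q) p + (m - 2) * gradInner gB f f p =
      f p * gradInner gB h f p

theorem IsWarpedProduct.isGRHS_iff [Nonempty κ] (H : IsWarpedProduct UB UF gB gF f)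
    (hh : ContDiffOn ℝ ∞ h UB) (hF : IsHarmonicEinstein UF gF u θ 0) (hUF : UF.Nonempty) :
    IsGRHS (productRegion UB UF) (warpedMetric gB f gF) (fun x => h (x ∘ Sum.inl))
      (fun x => u (x ∘ Sum.inr)) θ 0 ↔
        ∀ p ∈ UB, BaseSolitonEquations gB f h (Fintype.card κ) p := by
  constructor
  · intro hG p hp
    obtain ⟨q, hq⟩ := hUF
    have hx : Sum.elim p q ∈ productRegion UB UF := by simpa [productRegion] using ⟨hp, hq⟩
    constructor
    · intro i j
      simpa [H.ricci_inl_inl hx, H.hess_comp_inl_inl_inl hx, pd_inl_comp_inr] using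
        hG.soliton _ hx (Sum.inl i) (Sum.inl j)
    · obtain ⟨a, b, hab⟩ : ∃ a b, gF q a b ≠ 0 := by
        by_contra! hzero
        refine hF.metric.nondegenerate q hq ?_
        rw [show gF q = 0 from Matrix.ext hzero, Matrix.det_zero]
      have hsol := hG.soliton _ hx (Sum.inr a) (Sum.inr b)
      simp only [H.ricci_inr_inr hx, H.hess_comp_inl_inr_inr hx, pd_inr_comp_inr, Sum.elim_comp_inl,
        Sum.elim_comp_inr] at hsol
      have hein := hF.einstein q hq a b
      exact mul_right_cancel₀ hab (by linear_combination hein - hsol)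
  · intro hB
    refine ⟨H.isMetricOn, contDiffOn_comp_inl hh, contDiffOn_comp_inr hF.smooth_u, hF.theta_nonneg,
      ?_, fun x hx => ?_⟩
    · rintro x hx (i | a) (j | b)
      · simpa [H.ricci_inl_inl hx, H.hess_comp_inl_inl_inl hx, pd_inl_comp_inr] using
          (hB _ hx.1).1 i j
      · simp [H.ricci_inl_inr hx, H.hess_comp_inl_inl_inr hx, pd_inl_comp_inr]
      · simp [H.ricci_inr_inl hx, H.hess_comp_inl_inr_inl hx, pd_inl_comp_inr]
      · have hein := hF.einstein _ hx.2 a b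
        rw [H.ricci_inr_inr hx, H.hess_comp_inl_inr_inr hx, pd_inr_comp_inr, pd_inr_comp_inr]
        linear_combination hein - gF (x ∘ Sum.inr) a b * (hB _ hx.1).2
    · rw [H.tension_comp_inr hx, H.gradInner_comp_inr_comp_inl hx, hF.harmonic _ hx.2]
      simp

end WarpedProductSolitons

section ConformallyFlat

variable {ι : Type*} [Fintype ι] [DecidableEq ι] {U : Set (ι → ℝ)} {ε : ι → ℝ}
  {φ : (ι → ℝ) → ℝ} {x : ι → ℝ}

namespace IsSmoothNonzeroOn

theorem isMetricOn_conformalMetric (hφ : IsSmoothNonzeroOn U φ) (hε : ∀ i, ε i ≠ 0) :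
    IsMetricOn U (conformalMetric ε φ) where
  isOpen := hφ.isOpen
  smooth i j := by
    by_cases hij : i = j
    · subst hij
      simp only [conformalMetric, Matrix.diagonal_apply_eq]
      exact contDiffOn_const.div (hφ.smooth.pow 2) fun x hx => pow_ne_zero 2 (hφ.ne_zero x hx)
    · simpa [conformalMetric, Matrix.diagonal_apply_ne _ hij] using contDiffOn_const
  symm x _ := Matrix.isSymm_diagonal _
  nondegenerate x hx := by
    rw [conformalMetric, Matrix.det_diagonal, Finset.prod_ne_zero_iff]
    exact fun i _ => div_ne_zero (hε i) (pow_ne_zero 2 (hφ.ne_zero x hx))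

theorem inv_conformalMetric (hφ : IsSmoothNonzeroOn U φ) (hε : ∀ i, ε i ≠ 0) (hx : x ∈ U) :
    (conformalMetric ε φ x)⁻¹ = Matrix.diagonal fun i => φ x ^ 2 * (ε i)⁻¹ := by
  have hφx := hφ.ne_zero x hx
  refine Matrix.inv_eq_right_inv ?_
  rw [conformalMetric, Matrix.diagonal_mul_diagonal, ← Matrix.diagonal_one]
  congr 1
  funext i
  have hεi := hε i
  field_simp

theorem pd_conformalMetric (hφ : IsSmoothNonzeroOn U φ) (hx : x ∈ U) (i j k : ι) :
    pd i (fun y => conformalMetric ε φ y j k) x =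
      -2 * (if j = k then ε j else 0) / φ x ^ 2 * logPd i φ x := by
  have hφx := hφ.ne_zero x hx
  by_cases hjk : j = k
  · subst hjk
    have hd : HasDerivAt (fun s : ℝ => ε j / s ^ 2) (-2 * ε j / φ x ^ 3) (φ x) := by
      refine .congr_deriv (.div (hasDerivAt_const _ (ε j)) (hasDerivAt_pow 2 _) ?_) ?_
      · exact pow_ne_zero 2 hφx
      field_simp
      ring
    simp only [conformalMetric, Matrix.diagonal_apply_eq, if_true]
    rw [pd_comp hd.differentiableAt (hφ.differentiableAt hx), hd.deriv, logPd]
    field_simp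
  · simp [conformalMetric, hjk, pd_const]

theorem christoffel_conformalMetric (hφ : IsSmoothNonzeroOn U φ) (hε : ∀ i, ε i ≠ 0)
    (hx : x ∈ U) (k i j : ι) :
    christoffel (conformalMetric ε φ) k i j x =
      (if i = j then ε i / ε k else 0) * logPd k φ x - (if j = k then 1 else 0) * logPd i φ x -
        (if i = k then 1 else 0) * logPd j φ x := by
  have hφx := hφ.ne_zero x hx
  have hεk := hε k
  simp only [christoffel, hφ.inv_conformalMetric hε hx, hφ.pd_conformalMetric hx,
    Matrix.diagonal_apply, ite_mul, zero_mul, Finset.sum_ite_eq, Finset.mem_univ, if_true]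
  split_ifs <;> subst_vars <;> field_simp <;> ring

theorem sum_christoffel_conformalMetric (hφ : IsSmoothNonzeroOn U φ) (hε : ∀ i, ε i ≠ 0)
    (hx : x ∈ U) (l : ι) :
    ∑ k, christoffel (conformalMetric ε φ) k k l x = -(Fintype.card ι * logPd l φ x) := by
  simp [hφ.christoffel_conformalMetric hε hx, Finset.sum_sub_distrib, hε]

theorem pd_christoffel_conformalMetric (hφ : IsSmoothNonzeroOn U φ) (hε : ∀ i, ε i ≠ 0)
    (hx : x ∈ U) (l k i j : ι) :
    pd l (christoffel (conformalMetric ε φ) k i j) x =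
      (if i = j then ε i / ε k else 0) * pd l (logPd k φ) x -
        (if j = k then 1 else 0) * pd l (logPd i φ) x -
          (if i = k then 1 else 0) * pd l (logPd j φ) x := by
  have hd : ∀ a, DifferentiableAt ℝ (logPd a φ) x := hφ.differentiableAt_logPd hx
  rw [pd_congr hφ.isOpen hx fun y hy => hφ.christoffel_conformalMetric hε hy k i j, pd_sub,
    pd_sub, pd_const_mul (hd _), pd_const_mul (hd _), pd_const_mul (hd _)] <;> fun_prop

theorem ricci_conformalMetric (hφ : IsSmoothNonzeroOn U φ) (hε : ∀ i, ε i ≠ 0) (hx : x ∈ U)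
    (i j : ι) :
    ricci (conformalMetric ε φ) i j x =
      (Fintype.card ι - 2) * (pd j (logPd i φ) x + logPd i φ x * logPd j φ x) +
        (if i = j then ε i else 0) *
          ∑ k, (ε k)⁻¹ * (pd k (logPd k φ) x - (Fintype.card ι - 2) * logPd k φ x ^ 2) := by
  have hcomm := hφ.pd_logPd_comm hx i j
  simp only [ricci_eq, hφ.sum_christoffel_conformalMetric hε hx]
  simp only [hφ.pd_christoffel_conformalMetric hε hx, hφ.christoffel_conformalMetric hε hx]
  by_cases hij : i = j
  · subst hij
    simp only [if_true, div_eq_mul_inv, mul_assoc, ite_mul, one_mul, zero_mul,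
      Finset.sum_sub_distrib, Finset.sum_ite_eq, Finset.mem_univ, ne_eq, hε, not_false_eq_true,
      mul_inv_cancel_left₀, Finset.sum_const, Finset.card_univ, nsmul_eq_mul, sub_sub_cancel_left,
      sub_neg_eq_add, mul_sub, mul_left_comm, neg_mul, mul_neg, mul_ite, mul_zero,
      Finset.sum_neg_distrib, sub_mul, Finset.sum_ite_irrel, Finset.sum_ite_eq',
      sub_self, zero_sub, mul_add, two_mul, Finset.sum_add_distrib,
      Finset.mul_sum]
    ring_nf
  · have hji : j ≠ i := Ne.symm hij
    have hεi := hε i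
    have hεj := hε j
    simp only [hij, hji, if_false, zero_mul, ite_mul, one_mul, zero_sub, Finset.sum_sub_distrib,
      Finset.sum_neg_distrib, Finset.sum_ite_eq, Finset.mem_univ, if_true, ne_eq, hε,
      not_false_eq_true, div_self, Finset.sum_const, Finset.card_univ, nsmul_eq_mul,
      sub_sub_cancel_left, sub_neg_eq_add, mul_sub, mul_neg, mul_ite, neg_mul, mul_zero, neg_neg,
      sub_mul, Finset.sum_ite_irrel, Finset.sum_ite_eq', sub_zero,
      sub_self, add_zero]
    field_simp
    linear_combination (-1) * hcomm

theorem hess_conformalMetric (hφ : IsSmoothNonzeroOn U φ) (hε : ∀ i, ε i ≠ 0) (hx : x ∈ U)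
    (F : (ι → ℝ) → ℝ) (i j : ι) :
    hess (conformalMetric ε φ) F i j x =
      pd i (pd j F) x + logPd i φ x * pd j F x + logPd j φ x * pd i F x -
        (if i = j then ε i else 0) * ∑ k, (ε k)⁻¹ * (logPd k φ x * pd k F x) := by
  simp only [hess, hφ.christoffel_conformalMetric hε hx, sub_mul, Finset.sum_sub_distrib, ite_mul,
    zero_mul, one_mul, Finset.sum_ite_eq, Finset.mem_univ, if_true]
  split_ifs with hij
  · simp only [Finset.mul_sum, div_eq_mul_inv, mul_assoc]
    ring
  · simp only [Finset.sum_const_zero, zero_sub, sub_zero]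
    ring

theorem tension_conformalMetric (hφ : IsSmoothNonzeroOn U φ) (hε : ∀ i, ε i ≠ 0) (hx : x ∈ U)
    (F : (ι → ℝ) → ℝ) :
    tension (conformalMetric ε φ) F x =
      φ x ^ 2 * ∑ k, (ε k)⁻¹ *
        (pd k (pd k F) x - (Fintype.card ι - 2) * (logPd k φ x * pd k F x)) := by
  simp only [tension, hφ.inv_conformalMetric hε hx, Matrix.diagonal_apply, ite_mul, zero_mul,
    Finset.sum_ite_eq, Finset.mem_univ, if_true, hφ.hess_conformalMetric hε hx]
  simp only [Finset.mul_sum, mul_sub, mul_add, mul_assoc, mul_left_comm, ne_eq, hε,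
    not_false_eq_true, mul_inv_cancel_left₀, Finset.sum_sub_distrib, Finset.sum_add_distrib,
    Finset.sum_const, Finset.card_univ, nsmul_eq_mul, sub_mul, two_mul]
  ring

theorem gradInner_conformalMetric (hφ : IsSmoothNonzeroOn U φ) (hε : ∀ i, ε i ≠ 0)
    (hx : x ∈ U) (F G : (ι → ℝ) → ℝ) :
    gradInner (conformalMetric ε φ) F G x = φ x ^ 2 * ∑ k, (ε k)⁻¹ * (pd k F x * pd k G x) := by
  simp [gradInner, hφ.inv_conformalMetric hε hx, Matrix.diagonal_apply, Finset.mul_sum, mul_assoc]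

theorem grad_conformalMetric (hφ : IsSmoothNonzeroOn U φ) (hε : ∀ i, ε i ≠ 0) (hx : x ∈ U)
    (F : (ι → ℝ) → ℝ) (k : ι) :
    grad (conformalMetric ε φ) F k x = φ x ^ 2 * (ε k)⁻¹ * pd k F x := by
  simp [grad, hφ.inv_conformalMetric hε hx, Matrix.diagonal_apply]

theorem pd_mul_grad_conformalMetric (hφ : IsSmoothNonzeroOn U φ) (hε : ∀ i, ε i ≠ 0)
    {F G : (ι → ℝ) → ℝ} (hF : ContDiffOn ℝ ∞ F U) (hG : ContDiffOn ℝ ∞ G U) (hx : x ∈ U) (k : ι) :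
    pd k (fun y => F y * grad (conformalMetric ε φ) G k y) x =
      φ x ^ 2 * ((ε k)⁻¹ * (pd k F x * pd k G x + 2 * F x * (logPd k φ x * pd k G x) +
        F x * pd k (pd k G) x)) := by
  have hφx := hφ.ne_zero x hx
  have hdF := (hF.differentiableOn (by simp)).differentiableAt (hφ.isOpen.mem_nhds hx)
  have hdG := ((contDiffOn_pd hφ.isOpen hG k).differentiableOn (by simp)).differentiableAt
    (hφ.isOpen.mem_nhds hx)
  have hdφ := hφ.differentiableAt hx
  rw [pd_congr hφ.isOpen hx (G := fun y => (ε k)⁻¹ * (F y * (φ y * φ y * pd k G y)))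
    fun y hy => by rw [hφ.grad_conformalMetric hε hy]; ring, pd_const_mul (by fun_prop),
    pd_mul hdF (by fun_prop), pd_mul (F := fun y => φ y * φ y) (by fun_prop) hdG,
    pd_mul hdφ hdφ, logPd]
  field_simp
  ring

theorem divergence_mul_grad_conformalMetric (hφ : IsSmoothNonzeroOn U φ) (hε : ∀ i, ε i ≠ 0)
    {F G : (ι → ℝ) → ℝ} (hF : ContDiffOn ℝ ∞ F U) (hG : ContDiffOn ℝ ∞ G U) (hx : x ∈ U) :
    divergence (conformalMetric ε φ) (fun k y => F y * grad (conformalMetric ε φ) G k y) x =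
      F x * tension (conformalMetric ε φ) G x + gradInner (conformalMetric ε φ) F G x := by
  rw [divergence, Finset.sum_comm]
  simp only [← Finset.sum_mul, hφ.sum_christoffel_conformalMetric hε hx,
    hφ.pd_mul_grad_conformalMetric hε hF hG hx, hφ.grad_conformalMetric hε hx,
    hφ.tension_conformalMetric hε hx, hφ.gradInner_conformalMetric hε hx, Finset.mul_sum,
    ← Finset.sum_add_distrib]
  refine Finset.sum_congr rfl fun k _ => ?_
  ring

end IsSmoothNonzeroOn

end ConformallyFlat

section OneVariable

variable {I : Set ℝ} {F : ℝ → ℝ} {s : ℝ}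

theorem hasDerivAt_deriv (hI : IsOpen I) (hF : ContDiffOn ℝ ∞ F I) (hs : s ∈ I) :
    HasDerivAt F (deriv F s) s :=
  ((hF.differentiableOn (by simp)).differentiableAt (hI.mem_nhds hs)).hasDerivAt

theorem contDiffOn_deriv (hI : IsOpen I) (hF : ContDiffOn ℝ ∞ F I) : ContDiffOn ℝ ∞ (deriv F) I :=
  hF.deriv_of_isOpen hI (by simp)

namespace IsSmoothNonzeroOn

theorem contDiffOn_logDeriv (hF : IsSmoothNonzeroOn I F) : ContDiffOn ℝ ∞ (logDeriv F) I :=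
  (contDiffOn_deriv hF.isOpen hF.smooth).div hF.smooth hF.ne_zero

theorem deriv_deriv_div (hF : IsSmoothNonzeroOn I F) (hs : s ∈ I) :
    deriv (deriv F) s / F s = deriv (logDeriv F) s + logDeriv F s ^ 2 := by
  have hFs := hF.ne_zero s hs
  have hquot : deriv (logDeriv F) s = (deriv (deriv F) s * F s - deriv F s * deriv F s) / F s ^ 2 :=
    ((hasDerivAt_deriv hF.isOpen (contDiffOn_deriv hF.isOpen hF.smooth) hs).div
      (hasDerivAt_deriv hF.isOpen hF.smooth hs) hFs).deriv
  rw [hquot, logDeriv_apply]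
  field_simp
  ring

end IsSmoothNonzeroOn

end OneVariable

section LinearCoordinate

variable {ι : Type*} [Fintype ι] {J : Set ℝ} {F : ℝ → ℝ} {a x : ι → ℝ}

theorem contDiff_lin (a : ι → ℝ) : ContDiff ℝ ∞ (lin a) := by
  unfold lin
  fun_prop

theorem isOpen_lin_mem (hJ : IsOpen J) (a : ι → ℝ) : IsOpen {x | lin a x ∈ J} :=
  hJ.preimage (contDiff_lin a).continuous

theorem contDiffOn_comp_lin (hF : ContDiffOn ℝ ∞ F J) (a : ι → ℝ) :
    ContDiffOn ℝ ∞ (fun x => F (lin a x)) {x | lin a x ∈ J} :=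
  hF.comp (contDiff_lin a).contDiffOn fun _ hx => hx

theorem IsSmoothNonzeroOn.comp_lin (hF : IsSmoothNonzeroOn J F) (a : ι → ℝ) :
    IsSmoothNonzeroOn {x | lin a x ∈ J} fun x => F (lin a x) where
  isOpen := isOpen_lin_mem hF.isOpen a
  smooth := contDiffOn_comp_lin hF.smooth a
  ne_zero x hx := hF.ne_zero (lin a x) hx

theorem exists_lin_eq (ha : a ≠ 0) (s : ℝ) : ∃ x, lin a x = s := by
  classical
  obtain ⟨i, hi⟩ := Function.ne_iff.1 ha
  refine ⟨Pi.single i (s / a i), ?_⟩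
  simp only [lin, Pi.single_apply, mul_ite, mul_zero, Finset.sum_ite_eq', Finset.mem_univ, if_true]
  field_simp [show a i ≠ 0 from hi]

variable [DecidableEq ι]

theorem pd_lin (a x : ι → ℝ) (i : ι) : pd i (lin a) x = a i := by
  have hlin : lin a =
      ⇑(∑ i, a i • ContinuousLinearMap.proj (R := ℝ) (φ := fun _ : ι => ℝ) i) := by
    funext y
    simp [lin]
  rw [pd, hlin, ContinuousLinearMap.fderiv]
  simp [Pi.single_apply]

theorem pd_comp_lin (hF : DifferentiableAt ℝ F (lin a x)) (i : ι) :
    pd i (fun y => F (lin a y)) x = deriv F (lin a x) * a i := by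
  rw [pd_comp hF ((contDiff_lin a).differentiable (by simp) x), pd_lin]

theorem pd_pd_comp_lin (hJ : IsOpen J) (hF : ContDiffOn ℝ ∞ F J) (hx : lin a x ∈ J) (i j : ι) :
    pd i (pd j fun y => F (lin a y)) x = deriv (deriv F) (lin a x) * (a i * a j) := by
  rw [pd_congr (isOpen_lin_mem hJ a) hx (G := fun y => deriv F (lin a y) * a j) fun y hy =>
      pd_comp_lin (hasDerivAt_deriv hJ hF hy).differentiableAt j,
    pd_comp_lin (F := fun s => deriv F s * a j)
      ((hasDerivAt_deriv hJ (contDiffOn_deriv hJ hF) hx).differentiableAt.mul_const _),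
    deriv_mul_const_field]
  ring

theorem logPd_comp_lin (hF : DifferentiableAt ℝ F (lin a x)) (i : ι) :
    logPd i (fun y => F (lin a y)) x = logDeriv F (lin a x) * a i := by
  rw [logPd, pd_comp_lin hF, logDeriv_apply, div_mul_eq_mul_div]

theorem pd_logPd_comp_lin (hF : IsSmoothNonzeroOn J F) (hx : lin a x ∈ J) (i j : ι) :
    pd i (logPd j fun y => F (lin a y)) x = deriv (logDeriv F) (lin a x) * (a i * a j) := by
  rw [pd_congr (isOpen_lin_mem hF.isOpen a) hx (G := fun y => logDeriv F (lin a y) * a j)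
      fun y hy => logPd_comp_lin (hF.differentiableAt hy) j,
    pd_comp_lin (F := fun s => logDeriv F s * a j)
      ((hasDerivAt_deriv hF.isOpen hF.contDiffOn_logDeriv hx).differentiableAt.mul_const _),
    deriv_mul_const_field]
  ring

end LinearCoordinate

section Signs

variable {ι : Type*} {ε : ι → ℝ}

theorem ne_zero_of_eq_one_or_neg_one (hε : ∀ i, ε i = 1 ∨ ε i = -1) (i : ι) :
    ε i ≠ 0 := by
  rcases hε i with hi | hi <;> rw [hi] <;> norm_num

theorem sum_inv_mul_mul_self [Fintype ι] (hε : ∀ i, ε i = 1 ∨ ε i = -1) (a : ι → ℝ) (c : ℝ) :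
    ∑ k, (ε k)⁻¹ * (c * (a k * a k)) = c * sqNorm ε a := by
  rw [sqNorm, Finset.mul_sum]
  refine Finset.sum_congr rfl fun k _ => ?_
  rcases hε k with hk | hk <;> rw [hk] <;> ring

theorem rank_one_add_diagonal_eq_zero [Nontrivial ι] [DecidableEq ι] {v : ι → ℝ} (hε : ∀ i, ε i ≠ 0)
    (hv : v ≠ 0) {X Y : ℝ} (h : ∀ i j, X * (v i * v j) + (if i = j then ε i else 0) * Y = 0) :
    X = 0 ∧ Y = 0 := by
  obtain ⟨i, hi⟩ := Function.ne_iff.1 hv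
  obtain ⟨j, hji⟩ := exists_ne i
  have hij := h i j
  have hjj := h j j
  have hii := h i i
  simp only [if_true, if_neg hji.symm, zero_mul, add_zero, mul_eq_zero] at hij hjj hii
  rcases hij with hX | hvi | hvj
  · subst hX
    simpa [hε i] using hii
  · exact absurd hvi hi
  · have hY : Y = 0 := by simpa [hvj, hε j] using hjj
    subst hY
    simpa [show v i ≠ 0 from hi] using hii

end Signs

section Reduction

variable {ι : Type*} [Fintype ι] [DecidableEq ι] {ε α x : ι → ℝ} {I : Set ℝ} {φ f h u : ℝ → ℝ}
  {θ : ℝ}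

section Curvature

theorem ricci_conformalMetric_lin (hε : ∀ i, ε i = 1 ∨ ε i = -1) (hφ : IsSmoothNonzeroOn I φ)
    (hx : lin α x ∈ I) (i j : ι) :
    ricci (conformalMetric ε fun p => φ (lin α p)) i j x =
      (Fintype.card ι - 2) * (deriv (logDeriv φ) (lin α x) + logDeriv φ (lin α x) ^ 2) *
        (α i * α j) + (if i = j then ε i else 0) * (sqNorm ε α *
          (deriv (logDeriv φ) (lin α x) - (Fintype.card ι - 2) * logDeriv φ (lin α x) ^ 2)) := by
  rw [(hφ.comp_lin α).ricci_conformalMetric (ne_zero_of_eq_one_or_neg_one hε) hx,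
    mul_comm (sqNorm _ _), ← sum_inv_mul_mul_self hε]
  simp only [logPd_comp_lin (hφ.differentiableAt hx), pd_logPd_comp_lin hφ hx]
  ring_nf

theorem hess_conformalMetric_lin (hε : ∀ i, ε i = 1 ∨ ε i = -1) (hφ : IsSmoothNonzeroOn I φ)
    (hF : ContDiffOn ℝ ∞ f I) (hx : lin α x ∈ I) (i j : ι) :
    hess (conformalMetric ε fun p => φ (lin α p)) (fun p => f (lin α p)) i j x =
      (deriv (deriv f) (lin α x) + 2 * logDeriv φ (lin α x) * deriv f (lin α x)) * (α i * α j) -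
        (if i = j then ε i else 0) *
          (sqNorm ε α * (logDeriv φ (lin α x) * deriv f (lin α x))) := by
  rw [(hφ.comp_lin α).hess_conformalMetric (ne_zero_of_eq_one_or_neg_one hε) hx,
    mul_comm (sqNorm _ _), ← sum_inv_mul_mul_self hε]
  simp only [logPd_comp_lin (hφ.differentiableAt hx), pd_pd_comp_lin hφ.isOpen hF hx,
    pd_comp_lin (hasDerivAt_deriv hφ.isOpen hF hx).differentiableAt]
  ring_nf

theorem tension_conformalMetric_lin (hε : ∀ i, ε i = 1 ∨ ε i = -1) (hφ : IsSmoothNonzeroOn I φ)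
    (hF : ContDiffOn ℝ ∞ f I) (hx : lin α x ∈ I) :
    tension (conformalMetric ε fun p => φ (lin α p)) (fun p => f (lin α p)) x =
      φ (lin α x) ^ 2 * (sqNorm ε α * (deriv (deriv f) (lin α x) -
        (Fintype.card ι - 2) * logDeriv φ (lin α x) * deriv f (lin α x))) := by
  rw [(hφ.comp_lin α).tension_conformalMetric (ne_zero_of_eq_one_or_neg_one hε) hx,
    mul_comm (sqNorm _ _), ← sum_inv_mul_mul_self hε]
  simp only [logPd_comp_lin (hφ.differentiableAt hx), pd_pd_comp_lin hφ.isOpen hF hx,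
    pd_comp_lin (hasDerivAt_deriv hφ.isOpen hF hx).differentiableAt]
  congr 1
  exact Finset.sum_congr rfl fun k _ => by ring

theorem gradInner_conformalMetric_lin (hε : ∀ i, ε i = 1 ∨ ε i = -1) (hφ : IsSmoothNonzeroOn I φ)
    (hf : DifferentiableAt ℝ f (lin α x)) (hh : DifferentiableAt ℝ h (lin α x))
    (hx : lin α x ∈ I) :
    gradInner (conformalMetric ε fun p => φ (lin α p)) (fun p => f (lin α p))
        (fun p => h (lin α p)) x =
      φ (lin α x) ^ 2 * (sqNorm ε α * (deriv f (lin α x) * deriv h (lin α x))) := by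
  rw [(hφ.comp_lin α).gradInner_conformalMetric (ne_zero_of_eq_one_or_neg_one hε) hx,
    mul_comm (sqNorm _ _), ← sum_inv_mul_mul_self hε]
  simp only [pd_comp_lin hf, pd_comp_lin hh]
  congr 1
  exact Finset.sum_congr rfl fun k _ => by ring

end Curvature

/-- The ordinary differential equations on a harmonic-Einstein fiber of constant `0` and dimension
`m` whose data `τ`, `u` depend on a linear coordinate of square norm `N`. -/
def FiberODE (m θ N : ℝ) (J : Set ℝ) (τ u : ℝ → ℝ) : Prop :=
  ∀ ζ ∈ J, (m - 2) * (deriv (logDeriv τ) ζ + logDeriv τ ζ ^ 2) = θ * deriv u ζ ^ 2 ∧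
    N * (deriv (logDeriv τ) ζ - (m - 2) * logDeriv τ ζ ^ 2) = 0 ∧
    N * (deriv (deriv u) ζ - (m - 2) * logDeriv τ ζ * deriv u ζ) = 0

theorem isHarmonicEinstein_conformalMetric_lin_iff [Nontrivial ι]
    (hε : ∀ i, ε i = 1 ∨ ε i = -1) (hα : α ≠ 0) (hθ : 0 ≤ θ) (hφ : IsSmoothNonzeroOn I φ)
    (hu : ContDiffOn ℝ ∞ u I) :
    IsHarmonicEinstein {x | lin α x ∈ I} (conformalMetric ε fun p => φ (lin α p))
      (fun p => u (lin α p)) θ 0 ↔ FiberODE (Fintype.card ι) θ (sqNorm ε α) I φ u := by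
  have hε₀ := ne_zero_of_eq_one_or_neg_one hε
  constructor
  · intro H s hs
    obtain ⟨x, rfl⟩ := exists_lin_eq hα s
    have hein := H.einstein x hs
    have hharm := H.harmonic x hs
    simp only [ricci_conformalMetric_lin hε hφ hs,
      pd_comp_lin (hasDerivAt_deriv hφ.isOpen hu hs).differentiableAt, zero_mul] at hein
    rw [tension_conformalMetric_lin hε hφ hu hs] at hharm
    obtain ⟨hrank, hdiag⟩ := rank_one_add_diagonal_eq_zero hε₀ hα
      (X := (Fintype.card ι - 2) *
        (deriv (logDeriv φ) (lin α x) + logDeriv φ (lin α x) ^ 2) - θ * deriv u (lin α x) ^ 2)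
      (Y := sqNorm ε α * (deriv (logDeriv φ) (lin α x) -
        (Fintype.card ι - 2) * logDeriv φ (lin α x) ^ 2))
      fun i j => by linear_combination hein i j
    exact ⟨sub_eq_zero.1 hrank, hdiag,
      (mul_eq_zero.1 hharm).resolve_left (pow_ne_zero 2 (hφ.ne_zero _ hs))⟩
  · intro H
    refine ⟨(hφ.comp_lin α).isMetricOn_conformalMetric hε₀, contDiffOn_comp_lin hu α, hθ,
      fun x hx i j => ?_, fun x hx => ?_⟩
    · rw [ricci_conformalMetric_lin hε hφ hx, (H _ hx).1, (H _ hx).2.1,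
        pd_comp_lin (hasDerivAt_deriv hφ.isOpen hu hx).differentiableAt,
        pd_comp_lin (hasDerivAt_deriv hφ.isOpen hu hx).differentiableAt]
      ring
    · rw [tension_conformalMetric_lin hε hφ hu hx, (H _ hx).2.2, mul_zero]

/-- The ordinary differential equations on a warped product soliton with fibers of dimension `m`
over a conformally flat base of dimension `n` whose data `φ`, `f`, `h` depend on a linear coordinate
of square norm `N`. -/
def BaseODE (n m N : ℝ) (I : Set ℝ) (φ f h : ℝ → ℝ) : Prop :=
  ∀ ξ ∈ I,
    (n - 2) * (deriv (logDeriv φ) ξ + logDeriv φ ξ ^ 2) -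
        m * (deriv (logDeriv f) ξ + logDeriv f ξ ^ 2 + 2 * logDeriv φ ξ * logDeriv f ξ) +
        (deriv (deriv h) ξ + 2 * logDeriv φ ξ * deriv h ξ) = 0 ∧
    N * (deriv (logDeriv φ) ξ -
      logDeriv φ ξ * ((n - 2) * logDeriv φ ξ - m * logDeriv f ξ + deriv h ξ)) = 0 ∧
    N * (deriv (logDeriv f) ξ -
      logDeriv f ξ * ((n - 2) * logDeriv φ ξ - m * logDeriv f ξ + deriv h ξ)) = 0

theorem base_component_lin (hε : ∀ i, ε i = 1 ∨ ε i = -1) (hφ : IsSmoothNonzeroOn I φ)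
    (hf : IsSmoothNonzeroOn I f) (hh : ContDiffOn ℝ ∞ h I) (hx : lin α x ∈ I) (m : ℝ) (i j : ι) :
    ricci (conformalMetric ε fun p => φ (lin α p)) i j x -
        m / f (lin α x) *
          hess (conformalMetric ε fun p => φ (lin α p)) (fun p => f (lin α p)) i j x +
        hess (conformalMetric ε fun p => φ (lin α p)) (fun p => h (lin α p)) i j x =
      ((Fintype.card ι - 2) * (deriv (logDeriv φ) (lin α x) + logDeriv φ (lin α x) ^ 2) -
        m * (deriv (logDeriv f) (lin α x) + logDeriv f (lin α x) ^ 2 +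
          2 * logDeriv φ (lin α x) * logDeriv f (lin α x)) +
        (deriv (deriv h) (lin α x) + 2 * logDeriv φ (lin α x) * deriv h (lin α x))) *
          (α i * α j) +
      (if i = j then ε i else 0) * (sqNorm ε α * (deriv (logDeriv φ) (lin α x) -
        logDeriv φ (lin α x) * ((Fintype.card ι - 2) * logDeriv φ (lin α x) -
          m * logDeriv f (lin α x) + deriv h (lin α x)))) := by
  have hfx := hf.ne_zero _ hx
  have hf' : deriv f (lin α x) = logDeriv f (lin α x) * f (lin α x) := by
    rw [logDeriv_apply, div_mul_cancel₀ _ hfx]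
  rw [ricci_conformalMetric_lin hε hφ hx, hess_conformalMetric_lin hε hφ hf.smooth hx,
    hess_conformalMetric_lin hε hφ hh hx, (div_eq_iff hfx).1 (hf.deriv_deriv_div hx), hf']
  field_simp
  ring

theorem fiber_component_lin (hε : ∀ i, ε i = 1 ∨ ε i = -1) (hφ : IsSmoothNonzeroOn I φ)
    (hf : IsSmoothNonzeroOn I f) (hh : DifferentiableAt ℝ h (lin α x)) (hx : lin α x ∈ I) (m : ℝ) :
    divergence (conformalMetric ε fun p => φ (lin α p))
          (fun k p => f (lin α p) *
            grad (conformalMetric ε fun p => φ (lin α p)) (fun p => f (lin α p)) k p) x +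
        (m - 2) * gradInner (conformalMetric ε fun p => φ (lin α p)) (fun p => f (lin α p))
          (fun p => f (lin α p)) x -
        f (lin α x) * gradInner (conformalMetric ε fun p => φ (lin α p)) (fun p => h (lin α p))
          (fun p => f (lin α p)) x =
      φ (lin α x) ^ 2 * f (lin α x) ^ 2 * (sqNorm ε α * (deriv (logDeriv f) (lin α x) -
        logDeriv f (lin α x) * ((Fintype.card ι - 2) * logDeriv φ (lin α x) -
          m * logDeriv f (lin α x) + deriv h (lin α x)))) := by
  have hfx := hf.ne_zero _ hx
  have hf' : deriv f (lin α x) = logDeriv f (lin α x) * f (lin α x) := by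
    rw [logDeriv_apply, div_mul_cancel₀ _ hfx]
  have hfα := (hf.comp_lin α).smooth
  rw [(hφ.comp_lin α).divergence_mul_grad_conformalMetric (ne_zero_of_eq_one_or_neg_one hε) hfα hfα
      hx, tension_conformalMetric_lin hε hφ hf.smooth hx,
    gradInner_conformalMetric_lin hε hφ (hf.differentiableAt hx) (hf.differentiableAt hx) hx,
    gradInner_conformalMetric_lin hε hφ hh (hf.differentiableAt hx) hx,
    (div_eq_iff hfx).1 (hf.deriv_deriv_div hx), hf']
  ring

theorem baseSolitonEquations_lin_iff [Nontrivial ι] (hε : ∀ i, ε i = 1 ∨ ε i = -1) (hα : α ≠ 0)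
    (hφ : IsSmoothNonzeroOn I φ) (hf : IsSmoothNonzeroOn I f) (hh : ContDiffOn ℝ ∞ h I) (m : ℝ) :
    (∀ x ∈ {x | lin α x ∈ I}, BaseSolitonEquations (conformalMetric ε fun p => φ (lin α p))
      (fun p => f (lin α p)) (fun p => h (lin α p)) m x) ↔
        BaseODE (Fintype.card ι) m (sqNorm ε α) I φ f h := by
  constructor
  · intro H s hs
    obtain ⟨x, rfl⟩ := exists_lin_eq hα s
    obtain ⟨hbase, hfiber⟩ := H x hs
    simp only [base_component_lin hε hφ hf hh hs] at hbase
    rw [← sub_eq_zero,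
      fiber_component_lin hε hφ hf (hasDerivAt_deriv hφ.isOpen hh hs).differentiableAt hs] at hfiber
    obtain ⟨hrank, hdiag⟩ :=
      rank_one_add_diagonal_eq_zero (ne_zero_of_eq_one_or_neg_one hε) hα hbase
    have hφf : φ (lin α x) ^ 2 * f (lin α x) ^ 2 ≠ 0 :=
      mul_ne_zero (pow_ne_zero 2 (hφ.ne_zero _ hs)) (pow_ne_zero 2 (hf.ne_zero _ hs))
    exact ⟨hrank, hdiag, (mul_eq_zero.1 hfiber).resolve_left hφf⟩
  · intro H x hx
    obtain ⟨hrank, hφeq, hfeq⟩ := H _ hx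
    refine ⟨fun i j => ?_, sub_eq_zero.1 ?_⟩
    · rw [base_component_lin hε hφ hf hh hx, hrank, hφeq, zero_mul, mul_zero, add_zero]
    · rw [fiber_component_lin hε hφ hf (hasDerivAt_deriv hφ.isOpen hh hx).differentiableAt hx, hfeq,
        mul_zero]

end Reduction

theorem isSteadyWithSteadyFiber_iff {n m : ℕ} {ε α : Fin n → ℝ} {δ β : Fin m → ℝ} {θ : ℝ}
    {I J : Set ℝ} {φ f h τ u : ℝ → ℝ} (hn : 2 ≤ n) (hm : 2 ≤ m) (hθ : 0 ≤ θ)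
    (hε : ∀ i, ε i = 1 ∨ ε i = -1) (hδ : ∀ j, δ j = 1 ∨ δ j = -1) (hα : α ≠ 0) (hβ : β ≠ 0)
    (hJ : J.Nonempty) (hφ : IsSmoothNonzeroOn I φ) (hf : IsSmoothNonzeroOn I f)
    (hh : ContDiffOn ℝ ∞ h I) (hτ : IsSmoothNonzeroOn J τ) (hu : ContDiffOn ℝ ∞ u J) :
    IsSteadyWithSteadyFiber ε α δ β θ I J φ f h τ u ↔
      BaseODE n m (sqNorm ε α) I φ f h ∧ FiberODE m θ (sqNorm δ β) J τ u := by
  have : Nontrivial (Fin n) := Fin.nontrivial_iff_two_le.2 hn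
  have : Nontrivial (Fin m) := Fin.nontrivial_iff_two_le.2 hm
  have hfiber := isHarmonicEinstein_conformalMetric_lin_iff hδ hβ hθ hτ hu
  have hbase := baseSolitonEquations_lin_iff hε hα hφ hf hh (Fintype.card (Fin m))
  simp only [Fintype.card_fin] at hfiber hbase
  rw [← hfiber, ← hbase]
  refine and_congr_left fun hF => ?_
  have hwarped : IsWarpedProduct {x | lin α x ∈ I} {y | lin β y ∈ J}
      (conformalMetric ε fun p => φ (lin α p)) (conformalMetric δ fun q => τ (lin β q))
      fun p => f (lin α p) :=
    { base := (hφ.comp_lin α).isMetricOn_conformalMetric (ne_zero_of_eq_one_or_neg_one hε)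
      fiber := hF.metric
      warping := hf.comp_lin α }
  obtain ⟨s, hs⟩ := hJ
  obtain ⟨y, rfl⟩ := exists_lin_eq hβ s
  have hGRHS := hwarped.isGRHS_iff (contDiffOn_comp_lin hh α) hF ⟨y, hs⟩
  rw [Fintype.card_fin] at hGRHS
  exact hGRHS

section Interval

variable {I : Set ℝ} {F G a : ℝ → ℝ} {x y : ℝ}

theorem hasDerivAt_congr_of_eqOn (hI : IsOpen I) (hFG : Set.EqOn F G I) (hx : x ∈ I) {c : ℝ}
    (hG : HasDerivAt G c x) : HasDerivAt F c x :=
  hG.congr_of_eventuallyEq (hFG.eventuallyEq_of_mem (hI.mem_nhds hx))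

theorem exists_eq_add_const_of_hasDerivAt (hI : IsOpen I) (hI' : I.OrdConnected)
    (hF : ∀ s ∈ I, HasDerivAt F (a s) s) (hG : ∀ s ∈ I, HasDerivAt G (a s) s) :
    ∃ c, ∀ s ∈ I, F s = G s + c :=
  hI.exists_eq_add_of_deriv_eq hI'.isPreconnected
    (fun s hs => (hF s hs).differentiableAt.differentiableWithinAt)
    (fun s hs => (hG s hs).differentiableAt.differentiableWithinAt)
    fun s hs => (hF s hs).deriv.trans (hG s hs).deriv.symm

theorem NonConstOn.exists_deriv_ne_zero (hI : IsOpen I) (hI' : I.OrdConnected)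
    (hF : DifferentiableOn ℝ F I) (hnc : NonConstOn F I) : ∃ s ∈ I, deriv F s ≠ 0 := by
  by_contra! hzero
  obtain ⟨x, hx, y, hy, hxy⟩ := hnc
  exact hxy (hI.is_const_of_deriv_eq_zero hI'.isPreconnected hF hzero hx hy)

theorem hasDerivAt_integral (hI : IsOpen I) (hI' : I.OrdConnected) (ha : ContinuousOn a I)
    (hx : x ∈ I) (hy : y ∈ I) : HasDerivAt (fun t => ∫ s in x..t, a s) (a y) y :=
  intervalIntegral.integral_hasDerivAt_right
    (ha.mono (hI'.uIcc_subset hx hy)).intervalIntegrable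
    (ha.stronglyMeasurableAtFilter hI y hy) (ha.continuousAt (hI.mem_nhds hy))

theorem hasDerivAt_iff_eq_integral_add_const (hI : IsOpen I) (hI' : I.OrdConnected)
    (ha : ContinuousOn a I) (hx : x ∈ I) :
    (∀ s ∈ I, HasDerivAt F (a s) s) ↔ ∃ c, ∀ s ∈ I, F s = (∫ r in x..s, a r) + c := by
  constructor
  · exact fun hF => exists_eq_add_const_of_hasDerivAt hI hI' hF
      fun s hs => hasDerivAt_integral hI hI' ha hx hs
  · rintro ⟨c, hc⟩ s hs
    exact hasDerivAt_congr_of_eqOn hI hc hs ((hasDerivAt_integral hI hI' ha hx hs).add_const c)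

theorem hasDerivAt_mul_deriv_iff_eq_integral {p : ℝ → ℝ} (hI : IsOpen I) (hI' : I.OrdConnected)
    (hp : ContinuousOn p I) (hp₀ : ∀ s ∈ I, p s ≠ 0) (ha : ContinuousOn a I)
    (hF : DifferentiableOn ℝ F I) (hx : x ∈ I) :
    (∀ s ∈ I, HasDerivAt (fun r => p r * deriv F r) (a s) s) ↔
      ∃ c₁ c₂, ∀ t ∈ I, F t = (∫ s in x..t, (p s)⁻¹ * ((∫ r in x..s, a r) + c₁)) + c₂ := by
  rw [hasDerivAt_iff_eq_integral_add_const hI hI' ha hx]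
  refine exists_congr fun c₁ => ?_
  have hcont : ContinuousOn (fun s => (p s)⁻¹ * ((∫ r in x..s, a r) + c₁)) I :=
    (hp.inv₀ hp₀).mul fun s hs =>
      ((hasDerivAt_integral hI hI' ha hx hs).continuousAt.add_const c₁).continuousWithinAt
  rw [← hasDerivAt_iff_eq_integral_add_const hI hI' hcont hx]
  refine forall₂_congr fun s hs => ?_
  have hFs : HasDerivAt F (deriv F s) s := (hF.differentiableAt (hI.mem_nhds hs)).hasDerivAt
  rw [← eq_inv_mul_iff_mul_eq₀ (hp₀ s hs)]
  exact ⟨fun h => h ▸ hFs, fun h => hFs.unique h⟩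

theorem exists_eq_const_mul_of_linear_ode (hI : IsOpen I) (hI' : I.OrdConnected)
    (hF : ∀ s ∈ I, HasDerivAt F (a s * F s) s) (hG : ∀ s ∈ I, HasDerivAt G (a s * G s) s)
    (hG₀ : ∀ s ∈ I, G s ≠ 0) : ∃ c, ∀ s ∈ I, F s = c * G s := by
  have hquot : ∀ s ∈ I, HasDerivAt (fun r => F r / G r) 0 s := fun s hs =>
    ((hF s hs).fun_div (hG s hs) (hG₀ s hs)).congr_deriv (by ring)
  obtain ⟨c, hc⟩ := hI.exists_is_const_of_deriv_eq_zero hI'.isPreconnected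
    (fun s hs => (hquot s hs).differentiableAt.differentiableWithinAt)
    fun s hs => (hquot s hs).deriv
  exact ⟨c, fun s hs => (div_eq_iff (hG₀ s hs)).1 (hc s hs)⟩

theorem eq_zero_of_linear_ode (hI : IsOpen I) (hI' : I.OrdConnected) (ha : ContinuousOn a I)
    (hF : ∀ s ∈ I, HasDerivAt F (a s * F s) s) (hx : x ∈ I) (hFx : F x = 0) (hy : y ∈ I) :
    F y = 0 := by
  have hexp : ∀ s ∈ I, HasDerivAt (fun t => Real.exp (∫ r in x..t, a r))
      (a s * Real.exp (∫ r in x..s, a r)) s := fun s hs =>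
    (hasDerivAt_integral hI hI' ha hx hs).exp.congr_deriv (mul_comm _ _)
  obtain ⟨c, hc⟩ :=
    exists_eq_const_mul_of_linear_ode hI hI' hF hexp fun _ _ => Real.exp_ne_zero _
  have hc₀ : c = 0 := (mul_eq_zero.1 ((hc x hx).symm.trans hFx)).resolve_right (Real.exp_ne_zero _)
  rw [hc y hy, hc₀, zero_mul]

theorem exists_abs_eq_sign_mul (hI : IsPreconnected I) (hF : ContinuousOn F I)
    (hF₀ : ∀ s ∈ I, F s ≠ 0) : ∃ σ : ℝ, (σ = 1 ∨ σ = -1) ∧ ∀ s ∈ I, |F s| = σ * F s := by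
  rcases hI.eq_or_eq_neg_of_sq_eq (f := fun s => |F s|) hF.abs hF
    (fun s _ => by simp) (fun {s} hs => hF₀ s hs) with h | h
  · exact ⟨1, Or.inl rfl, fun s hs => by simpa using h hs⟩
  · exact ⟨-1, Or.inr rfl, fun s hs => by simpa using h hs⟩

theorem hasDerivAt_abs_rpow {c : ℝ} (hF : HasDerivAt F c x) (hFx : F x ≠ 0) (p : ℝ) :
    HasDerivAt (fun s => |F s| ^ p) (p * (c / F x) * |F x| ^ p) x := by
  have hexp : ∀ {t : ℝ}, t ≠ 0 → |t| ^ p = Real.exp (Real.log t * p) := fun ht => by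
    rw [Real.rpow_def_of_pos (abs_pos.2 ht), Real.log_abs]
  rw [hexp hFx]
  refine HasDerivAt.congr_of_eventuallyEq (f := fun s => Real.exp (Real.log (F s) * p))
    (((hF.log hFx).mul_const p).exp.congr_deriv (by ring)) ?_
  filter_upwards [hF.continuousAt.eventually_ne hFx] with s hs using hexp hs

end Interval

section Affine

variable {I : Set ℝ} {F : ℝ → ℝ} {N b c x : ℝ}

theorem hasDerivAt_affine (N b x : ℝ) : HasDerivAt (fun s => N * s + b) N x := by
  simpa using ((hasDerivAt_id x).const_mul N).add_const b

theorem hasDerivAt_log_affine (hx : N * x + b ≠ 0) :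
    HasDerivAt (fun s => Real.log |N * s + b|) (N / (N * x + b)) x := by
  simpa only [Real.log_abs] using (hasDerivAt_affine N b x).log hx

theorem hasDerivAt_const_div_affine (hx : N * x + b ≠ 0) (c : ℝ) :
    HasDerivAt (fun s => c / (N * s + b)) (-(c * N) / (N * x + b) ^ 2) x :=
  ((hasDerivAt_const x c).fun_div (hasDerivAt_affine N b x) hx).congr_deriv (by ring)

theorem exists_eq_mul_log_affine_add_const (hI : IsOpen I) (hI' : I.OrdConnected) (hN : N ≠ 0)
    (hne : ∀ s ∈ I, N * s + b ≠ 0) (hF : ∀ s ∈ I, HasDerivAt F (c / (N * s + b)) s) :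
    ∃ C, ∀ s ∈ I, F s = c / N * Real.log |N * s + b| + C :=
  exists_eq_add_const_of_hasDerivAt hI hI' hF fun s hs =>
    ((hasDerivAt_log_affine (hne s hs)).const_mul (c / N)).congr_deriv
      (div_mul_div_cancel₀ hN)

theorem exists_eq_mul_abs_affine_rpow (hF : IsSmoothNonzeroOn I F) (hF₀ : ∀ s ∈ I, 0 < F s)
    (hI' : I.OrdConnected) (hN : N ≠ 0) (hne : ∀ s ∈ I, N * s + b ≠ 0)
    (hlog : ∀ s ∈ I, logDeriv F s = c / (N * s + b)) :
    ∃ C, 0 < C ∧ ∀ s ∈ I, F s = C * |N * s + b| ^ (c / N) := by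
  obtain ⟨C, hC⟩ := exists_eq_mul_log_affine_add_const (F := fun s => Real.log (F s)) hF.isOpen hI'
    hN hne fun s hs => ((hasDerivAt_deriv hF.isOpen hF.smooth hs).log (hF₀ s hs).ne').congr_deriv
      (hlog s hs)
  refine ⟨Real.exp C, Real.exp_pos C, fun s hs => ?_⟩
  rw [Real.rpow_def_of_pos (abs_pos.2 (hne s hs)), ← Real.exp_add, ← Real.exp_log (hF₀ s hs),
    hC s hs]
  ring_nf

theorem logDeriv_eq_of_eq_mul_abs_affine_rpow {C e : ℝ} (hI : IsOpen I) (hC : C ≠ 0)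
    (hF : ∀ s ∈ I, F s = C * |N * s + b| ^ e) (hx : x ∈ I) (hne : N * x + b ≠ 0) :
    logDeriv F x = e * N / (N * x + b) := by
  have hpow : |N * x + b| ^ e ≠ 0 := (Real.rpow_pos_of_pos (abs_pos.2 hne) e).ne'
  rw [logDeriv_apply, (hasDerivAt_congr_of_eqOn hI hF hx
    ((hasDerivAt_abs_rpow (hasDerivAt_affine N b x) hne e).const_mul C)).deriv, hF x hx]
  field_simp

theorem exists_eq_neg_inv_affine_of_riccati (hI : IsOpen I) (hI' : I.OrdConnected)
    (hF₀ : ∀ s ∈ I, F s ≠ 0) (hF : ∀ s ∈ I, HasDerivAt F (N * F s ^ 2) s) :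
    ∃ b, ∀ s ∈ I, N * s + b ≠ 0 ∧ F s = -1 / (N * s + b) := by
  have hinv : ∀ s ∈ I, HasDerivAt (fun r => -(F r)⁻¹) N s := fun s hs =>
    ((hF s hs).fun_inv (hF₀ s hs)).fun_neg.congr_deriv (by have := hF₀ s hs; field_simp)
  obtain ⟨b, hb⟩ := exists_eq_add_const_of_hasDerivAt (G := fun s => N * s) hI hI' hinv
    fun s _ => by simpa using hasDerivAt_affine N 0 s
  refine ⟨b, fun s hs => ?_⟩
  have hFs := hF₀ s hs
  rw [← hb s hs]
  exact ⟨neg_ne_zero.2 (inv_ne_zero hFs), by field_simp⟩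

end Affine

section NullFiber

variable {m : ℕ} {θ ζ₀ : ℝ} {J : Set ℝ} {τ u : ℝ → ℝ}

theorem fiberODE_zero_iff (hθ : θ ≠ 0) (hτ : IsSmoothNonzeroOn J τ) (m : ℝ) :
    FiberODE m θ 0 J τ u ↔
      ∀ s ∈ J, (m - 2) / θ * (deriv (deriv τ) s / τ s) = deriv u s ^ 2 := by
  refine forall₂_congr fun s hs => ?_
  rw [hτ.deriv_deriv_div hs, zero_mul, zero_mul, and_self, and_iff_left rfl, div_mul_eq_mul_div,
    div_eq_iff hθ, mul_comm θ]

theorem fiberODE_zero_iff_fiberNull (hm : 2 < m) (hθ : 0 < θ) (hτ : IsSmoothNonzeroOn J τ)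
    (hJ : J.OrdConnected) (hζ₀ : ζ₀ ∈ J) (hu : ContDiffOn ℝ ∞ u J) :
    FiberODE m θ 0 J τ u ↔ FiberNull m θ J ζ₀ τ u := by
  have hm' : (0 : ℝ) < m - 2 := sub_pos.2 (by exact_mod_cast hm)
  rw [fiberODE_zero_iff hθ.ne' hτ]
  constructor
  · intro H
    have hsign : ∀ s ∈ J, (if 0 ≤ deriv u s then (1 : ℝ) else -1) *
        √((m - 2) / θ * (deriv (deriv τ) s / τ s)) = deriv u s := by
      intro s hs
      rw [H s hs, Real.sqrt_sq_eq_abs]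
      split_ifs with h
      · rw [abs_of_nonneg h, one_mul]
      · rw [abs_of_neg (not_le.1 h), neg_one_mul, neg_neg]
    have hcont : ContinuousOn (fun s => (if 0 ≤ deriv u s then (1 : ℝ) else -1) *
        √((m - 2) / θ * (deriv (deriv τ) s / τ s))) J :=
      (contDiffOn_deriv hτ.isOpen hu).continuousOn.congr hsign
    obtain ⟨c, hc⟩ := (hasDerivAt_iff_eq_integral_add_const hτ.isOpen hJ hcont hζ₀).1
      fun s hs => (hasDerivAt_deriv hτ.isOpen hu hs).congr_deriv (hsign s hs).symm
    refine ⟨fun s hs => ?_, _, c, fun s _ => ?_, hcont, hc⟩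
    · exact nonneg_of_mul_nonneg_right ((sq_nonneg _).trans_eq (H s hs).symm) (by positivity)
    · exact ite_eq_or_eq _ _ _
  · rintro ⟨hnonneg, σ, c, hσ, hcont, hu'⟩ s hs
    have hσs : σ s ^ 2 = 1 := sq_eq_one_iff.2 (hσ s hs)
    rw [((hasDerivAt_iff_eq_integral_add_const hτ.isOpen hJ hcont hζ₀).2 ⟨c, hu'⟩ s hs).deriv,
      mul_pow, hσs, one_mul, Real.sq_sqrt (mul_nonneg (by positivity) (hnonneg s hs))]

end NullFiber

section UnitFiber

variable {m : ℕ} {θ : ℝ} {J : Set ℝ} {τ u : ℝ → ℝ}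

/-- A first integral of the fiber equations for `N = 1`: both `τ'/τ` and `u'` are constant multiples
of the reciprocal of one affine function of slope `m - 2`. -/
def IsReciprocalFiber (m θ : ℝ) (J : Set ℝ) (τ u : ℝ → ℝ) : Prop :=
  ∃ c K : ℝ, θ * K ^ 2 = (m - 1) * (m - 2) ∧ ∀ ζ ∈ J, (m - 2) * ζ + c ≠ 0 ∧
    logDeriv τ ζ = -1 / ((m - 2) * ζ + c) ∧ deriv u ζ = K / ((m - 2) * ζ + c)

theorem FiberODE.isReciprocalFiber {m : ℝ} (H : FiberODE m θ 1 J τ u) (hθ : 0 < θ)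
    (hτ : IsSmoothNonzeroOn J τ) (hJ : J.OrdConnected) (hu : ContDiffOn ℝ ∞ u J)
    (hnc : NonConstOn u J) : IsReciprocalFiber m θ J τ u := by
  simp only [FiberODE, one_mul, sub_eq_zero] at H
  have hτ' := hτ.contDiffOn_logDeriv
  have hriccati : ∀ s ∈ J, HasDerivAt (logDeriv τ) ((m - 2) * logDeriv τ s ^ 2) s := fun s hs =>
    (H s hs).2.1 ▸ hasDerivAt_deriv hτ.isOpen hτ' hs
  have hu'ode : ∀ s ∈ J, HasDerivAt (deriv u) ((m - 2) * logDeriv τ s * deriv u s) s :=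
    fun s hs => (H s hs).2.2 ▸ hasDerivAt_deriv hτ.isOpen (contDiffOn_deriv hτ.isOpen hu) hs
  have hsq : ∀ s ∈ J, θ * deriv u s ^ 2 = (m - 1) * (m - 2) * logDeriv τ s ^ 2 := fun s hs => by
    rw [← (H s hs).1, (H s hs).2.1]
    ring
  obtain ⟨s₀, hs₀, hus₀⟩ := hnc.exists_deriv_ne_zero hτ.isOpen hJ (hu.differentiableOn (by simp))
  have hu'₀ : ∀ s ∈ J, deriv u s ≠ 0 := fun s hs h => hus₀ <|
    eq_zero_of_linear_ode hτ.isOpen hJ (hτ'.continuousOn.const_mul (m - 2)) hu'ode hs h hs₀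
  have hlog₀ : ∀ s ∈ J, logDeriv τ s ≠ 0 := fun s hs h => by
    have := hsq s hs
    rw [h] at this
    simp [hθ.ne', hu'₀ s hs] at this
  obtain ⟨k, hk⟩ := exists_eq_const_mul_of_linear_ode (a := fun s => (m - 2) * logDeriv τ s)
    hτ.isOpen hJ hu'ode (fun s hs => (hriccati s hs).congr_deriv (by ring)) hlog₀
  obtain ⟨c, hc⟩ := exists_eq_neg_inv_affine_of_riccati hτ.isOpen hJ hlog₀ hriccati
  refine ⟨c, -k, mul_right_cancel₀ (pow_ne_zero 2 (hlog₀ s₀ hs₀)) ?_,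
    fun s hs => ⟨(hc s hs).1, (hc s hs).2, ?_⟩⟩
  · rw [← hsq s₀ hs₀, hk s₀ hs₀]
    ring
  · rw [hk s hs, (hc s hs).2]
    ring

theorem IsReciprocalFiber.fiberODE {m : ℝ} (H : IsReciprocalFiber m θ J τ u) (hJ : IsOpen J)
    (N : ℝ) : FiberODE m θ N J τ u := by
  obtain ⟨c, K, hK, H⟩ := H
  intro s hs
  obtain ⟨hne, hlog, hu⟩ := H s hs
  have hlog' := (hasDerivAt_congr_of_eqOn hJ (fun r hr => (H r hr).2.1) hs
    (hasDerivAt_const_div_affine hne (-1))).deriv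
  have hu' := (hasDerivAt_congr_of_eqOn hJ (fun r hr => (H r hr).2.2) hs
    (hasDerivAt_const_div_affine hne K)).deriv
  rw [hlog', hu', hlog, hu]
  refine ⟨?_, ?_, ?_⟩
  · rw [div_pow K, ← mul_div_assoc, hK]
    field_simp
    ring
  · field_simp
    ring
  · field_simp
    ring

theorem div_sqrt_mul_sq_of_abs_eq {σ x : ℝ} (hθ : 0 ≤ θ) (hσ : σ = 1 ∨ σ = -1) (hx : x ≠ 0)
    (habs : |x| = σ * x) : x / √(θ * x ^ 2) = σ / √θ := by
  rw [Real.sqrt_mul hθ, Real.sqrt_sq_eq_abs, habs]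
  rcases hσ with rfl | rfl <;> field_simp

theorem mul_log_div_sqrt_eq {σ x R c : ℝ} (hθ : 0 ≤ θ) (hσ : σ = 1 ∨ σ = -1) (hx : x ≠ 0)
    (habs : |x| = σ * x) :
    R * x * Real.log |x| / (c * √(θ * x ^ 2)) = σ * R / √θ / c * Real.log |x| := by
  rw [show R * x * Real.log |x| / (c * √(θ * x ^ 2)) =
    R * (x / √(θ * x ^ 2)) / c * Real.log |x| by ring, div_sqrt_mul_sq_of_abs_eq hθ hσ hx habs]
  ring

theorem IsReciprocalFiber.fiberUnit (H : IsReciprocalFiber m θ J τ u) (hm : 2 < m) (hθ : 0 < θ)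
    (hτ : IsSmoothNonzeroOn J τ) (hτ₀ : ∀ ζ ∈ J, 0 < τ ζ) (hJ : J.OrdConnected)
    (hu : ContDiffOn ℝ ∞ u J) : FiberUnit m θ J τ u := by
  have hm' : (m : ℝ) - 2 ≠ 0 := sub_ne_zero.2 (by exact_mod_cast hm.ne')
  obtain ⟨c₁, K, hK, H⟩ := H
  have hne : ∀ s ∈ J, ((m : ℝ) - 2) * s + c₁ ≠ 0 := fun s hs => (H s hs).1
  obtain ⟨c₂, hc₂, hτeq⟩ :=
    exists_eq_mul_abs_affine_rpow hτ hτ₀ hJ hm' hne fun s hs => (H s hs).2.1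
  obtain ⟨c₃, hueq⟩ := exists_eq_mul_log_affine_add_const hτ.isOpen hJ hm' hne
    fun s hs => (H s hs).2.2 ▸ hasDerivAt_deriv hτ.isOpen hu hs
  obtain ⟨σ, hσ, habs⟩ := exists_abs_eq_sign_mul hJ.isPreconnected
    (F := fun s => ((m : ℝ) - 2) * s + c₁) (by fun_prop) hne
  have hσσ : σ * σ = 1 := mul_self_eq_one_iff.2 hσ
  obtain ⟨ρ, hρ, hKρ⟩ : ∃ ρ : ℝ, (ρ = 1 ∨ ρ = -1) ∧
      K = ρ * √(2 - 3 * (m : ℝ) + (m : ℝ) ^ 2) / √θ := by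
    have hKθ : 2 - 3 * (m : ℝ) + (m : ℝ) ^ 2 = θ * K ^ 2 := by rw [hK]; ring
    rw [hKθ, Real.sqrt_mul hθ.le, Real.sqrt_sq_eq_abs]
    rcases abs_choice K with h | h
    · exact ⟨1, Or.inl rfl, by rw [h]; field_simp⟩
    · exact ⟨-1, Or.inr rfl, by rw [h]; field_simp⟩
  refine ⟨c₁, c₂, c₃, ρ * σ, hc₂, ?_, fun ζ hζ => ⟨hne ζ hζ, ?_, ?_⟩⟩
  · rcases hρ with rfl | rfl <;> rcases hσ with rfl | rfl <;> norm_num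
  · rw [hτeq ζ hζ, ← neg_sub (m : ℝ) 2, div_neg, neg_div]
  · rw [hueq ζ hζ, mul_log_div_sqrt_eq hθ.le hσ (hne ζ hζ) (habs ζ hζ), hKρ]
    linear_combination (-ρ * √(2 - 3 * (m : ℝ) + (m : ℝ) ^ 2) / √θ / (m - 2) *
      Real.log |((m : ℝ) - 2) * ζ + c₁|) * hσσ

theorem FiberUnit.isReciprocalFiber (H : FiberUnit m θ J τ u) (hm : 2 < m) (hθ : 0 < θ)
    (hJ : IsOpen J) (hJ' : J.OrdConnected) : IsReciprocalFiber m θ J τ u := by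
  have hm' : (2 : ℝ) < m := by exact_mod_cast hm
  obtain ⟨c₁, c₂, c₃, ρ, hc₂, hρ, H⟩ := H
  have hne : ∀ s ∈ J, ((m : ℝ) - 2) * s + c₁ ≠ 0 := fun s hs => (H s hs).1
  obtain ⟨σ, hσ, habs⟩ := exists_abs_eq_sign_mul hJ'.isPreconnected
    (F := fun s => ((m : ℝ) - 2) * s + c₁) (by fun_prop) hne
  have hρσ : (ρ * σ) ^ 2 = 1 := by
    rw [mul_pow, sq_eq_one_iff.2 hρ, sq_eq_one_iff.2 hσ, one_mul]
  refine ⟨c₁, ρ * (σ * √(2 - 3 * (m : ℝ) + (m : ℝ) ^ 2) / √θ), ?_,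
    fun s hs => ⟨hne s hs, ?_, ?_⟩⟩
  · have hR : (0 : ℝ) ≤ 2 - 3 * m + m ^ 2 := by nlinarith
    rw [← mul_div_assoc, ← mul_assoc, div_pow, mul_pow, hρσ, Real.sq_sqrt hR, Real.sq_sqrt hθ.le]
    field_simp
    ring
  · rw [logDeriv_eq_of_eq_mul_abs_affine_rpow hJ hc₂.ne' (fun r hr => (H r hr).2.1) hs (hne s hs),
      ← neg_sub (m : ℝ) 2]
    field_simp [(sub_pos.2 hm').ne']
  · have hu : Set.EqOn u _ J := fun r hr => by
      rw [(H r hr).2.2, mul_log_div_sqrt_eq hθ.le hσ (hne r hr) (habs r hr)]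
    rw [(hasDerivAt_congr_of_eqOn hJ hu hs ((((hasDerivAt_log_affine (hne s hs)).const_mul
      _).const_mul ρ).const_add c₃)).deriv]
    field_simp [(sub_pos.2 hm').ne']

theorem fiberODE_one_iff_fiberUnit (hm : 2 < m) (hθ : 0 < θ) (hτ : IsSmoothNonzeroOn J τ)
    (hτ₀ : ∀ ζ ∈ J, 0 < τ ζ) (hJ : J.OrdConnected) (hu : ContDiffOn ℝ ∞ u J)
    (hnc : NonConstOn u J) : FiberODE m θ 1 J τ u ↔ FiberUnit m θ J τ u :=
  ⟨fun H => (H.isReciprocalFiber hθ hτ hJ hu hnc).fiberUnit hm hθ hτ hτ₀ hJ hu,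
    fun H => (H.isReciprocalFiber hm hθ hτ.isOpen hJ).fiberODE hτ.isOpen 1⟩

end UnitFiber

section NullBase

variable {ξ₀ s : ℝ} {I : Set ℝ} {φ f h : ℝ → ℝ}

/-- The right-hand side `E` of the base equation for `N = 0`, written as `(φ² h')' = E`. -/
def potentialSource (n m : ℝ) (φ f : ℝ → ℝ) (r : ℝ) : ℝ :=
  m * (deriv (deriv f) r / f r) * φ r ^ 2 + 2 * m * φ r * deriv φ r * (deriv f r / f r) -
    (n - 2) * φ r * deriv (deriv φ) r

theorem continuousOn_potentialSource (hφ : IsSmoothNonzeroOn I φ) (hf : IsSmoothNonzeroOn I f)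
    (n m : ℝ) : ContinuousOn (potentialSource n m φ f) I := by
  have hf₀ := hf.ne_zero
  have hφc := hφ.smooth.continuousOn
  have hfc := hf.smooth.continuousOn
  have hφ' := contDiffOn_deriv hφ.isOpen hφ.smooth
  have hf' := contDiffOn_deriv hf.isOpen hf.smooth
  have hφ'c := hφ'.continuousOn
  have hf'c := hf'.continuousOn
  have hφ''c := (contDiffOn_deriv hφ.isOpen hφ').continuousOn
  have hf''c := (contDiffOn_deriv hf.isOpen hf').continuousOn
  unfold potentialSource
  fun_prop (disch := assumption)

theorem potentialSource_eq (hφ : IsSmoothNonzeroOn I φ) (hf : IsSmoothNonzeroOn I f) (hs : s ∈ I)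
    (n m : ℝ) :
    potentialSource n m φ f s =
      φ s ^ 2 * (m * (deriv (logDeriv f) s + logDeriv f s ^ 2 + 2 * logDeriv φ s * logDeriv f s) -
        (n - 2) * (deriv (logDeriv φ) s + logDeriv φ s ^ 2)) := by
  have hφs := hφ.ne_zero s hs
  rw [← hf.deriv_deriv_div hs, ← hφ.deriv_deriv_div hs, potentialSource, logDeriv_apply,
    logDeriv_apply]
  field_simp

theorem hasDerivAt_sq_mul_deriv (hφ : IsSmoothNonzeroOn I φ) (hh : ContDiffOn ℝ ∞ h I)
    (hs : s ∈ I) :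
    HasDerivAt (fun r => φ r ^ 2 * deriv h r)
      (φ s ^ 2 * (deriv (deriv h) s + 2 * logDeriv φ s * deriv h s)) s := by
  have hφs := hφ.ne_zero s hs
  refine (((hasDerivAt_deriv hφ.isOpen hφ.smooth hs).fun_pow 2).fun_mul
    (hasDerivAt_deriv hφ.isOpen (contDiffOn_deriv hφ.isOpen hh) hs)).congr_deriv ?_
  rw [logDeriv_apply]
  field_simp
  push_cast
  ring

theorem baseODE_zero_iff (hφ : IsSmoothNonzeroOn I φ) (hf : IsSmoothNonzeroOn I f)
    (hh : ContDiffOn ℝ ∞ h I) (n m : ℝ) :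
    BaseODE n m 0 I φ f h ↔
      ∀ s ∈ I, HasDerivAt (fun r => φ r ^ 2 * deriv h r) (potentialSource n m φ f s) s := by
  refine forall₂_congr fun s hs => ?_
  have hφs : φ s ^ 2 ≠ 0 := pow_ne_zero 2 (hφ.ne_zero s hs)
  have hderiv := hasDerivAt_sq_mul_deriv hφ hh hs
  rw [potentialSource_eq hφ hf hs, zero_mul, zero_mul, and_self, and_iff_left rfl]
  constructor
  · intro H
    exact hderiv.congr_deriv (by rw [mul_right_inj' hφs]; linarith)
  · intro H
    have := mul_left_cancel₀ hφs (hderiv.unique H)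
    linarith

theorem baseODE_zero_iff_baseNull {n m : ℕ} (hφ : IsSmoothNonzeroOn I φ)
    (hf : IsSmoothNonzeroOn I f) (hI : I.OrdConnected) (hh : ContDiffOn ℝ ∞ h I) (hξ₀ : ξ₀ ∈ I) :
    BaseODE n m 0 I φ f h ↔ BaseNull n m I ξ₀ φ f h :=
  (baseODE_zero_iff hφ hf hh n m).trans <|
    hasDerivAt_mul_deriv_iff_eq_integral hφ.isOpen hI (hφ.smooth.continuousOn.pow 2)
      (fun s hs => pow_ne_zero 2 (hφ.ne_zero s hs)) (continuousOn_potentialSource hφ hf n m)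
      (hh.differentiableOn (by simp)) hξ₀

end NullBase

section RootD

variable {n m : ℕ} {N : ℝ}

theorem rootD_sq (hn : 1 ≤ n) (m : ℕ) (k : ℝ) : rootD n m k ^ 2 = m + k ^ 2 * ((n : ℝ) - 1) := by
  have hn' : (0 : ℝ) ≤ n - 1 := sub_nonneg.2 (by exact_mod_cast hn)
  exact Real.sq_sqrt (by positivity)

theorem abs_lt_rootD (hn : 2 ≤ n) (hm : 1 ≤ m) (k : ℝ) : |k| < rootD n m k := by
  have hn' : (2 : ℝ) ≤ n := by exact_mod_cast hn
  have hm' : (1 : ℝ) ≤ m := by exact_mod_cast hm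
  refine Real.lt_sqrt_of_sq_lt ?_
  rw [sq_abs]
  nlinarith [sq_nonneg k]

theorem rootD_pos (hn : 2 ≤ n) (hm : 1 ≤ m) (k : ℝ) : 0 < rootD n m k :=
  (abs_nonneg k).trans_lt (abs_lt_rootD hn hm k)

theorem ne_zero_of_eq_neg_add_or_sub_rootD (hn : 2 ≤ n) (hm : 1 ≤ m) {k : ℝ}
    (hN : N = -k + rootD n m k ∨ N = -k - rootD n m k) : N ≠ 0 := by
  obtain ⟨hlower, hupper⟩ := abs_lt.1 (abs_lt_rootD hn hm k)
  rcases hN with rfl | rfl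
  · exact (by linarith : 0 < -k + rootD n m k).ne'
  · exact (by linarith : -k - rootD n m k < 0).ne

end RootD

section UnitBase

variable {n m : ℕ} {k N : ℝ} {I : Set ℝ} {φ f h z : ℝ → ℝ}

/-- The base equations for `N = 1` as an autonomous first-order system for `f'/f` and the auxiliary
function `z`, along which `φ'/φ` and `h'` are the multiples `k` and `z + m - k (n - 2)` of
`f'/f`. -/
structure IsReducedBase (n m : ℕ) (k : ℝ) (z : ℝ → ℝ) (I : Set ℝ) (φ f h : ℝ → ℝ) : Prop where
  isOpen : IsOpen I
  logDeriv_eq : ∀ s ∈ I, logDeriv φ s = k * logDeriv f s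
  deriv_eq : ∀ s ∈ I, deriv h s = (z s + m - k * (n - 2)) * logDeriv f s
  hasDerivAt_logDeriv : ∀ s ∈ I, HasDerivAt (logDeriv f) (z s * logDeriv f s ^ 2) s
  hasDerivAt_aux : ∀ s ∈ I,
    HasDerivAt z (-logDeriv f s * (z s + k - rootD n m k) * (z s + k + rootD n m k)) s

theorem IsReducedBase.baseODE (H : IsReducedBase n m k z I φ f h) (hn : 1 ≤ n) (N : ℝ) :
    BaseODE n m N I φ f h := by
  intro s hs
  have hφ' := (hasDerivAt_congr_of_eqOn H.isOpen H.logDeriv_eq hs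
    ((H.hasDerivAt_logDeriv s hs).const_mul k)).deriv
  have hh' := (hasDerivAt_congr_of_eqOn H.isOpen H.deriv_eq hs
    ((((H.hasDerivAt_aux s hs).add_const (m : ℝ)).sub_const (k * (n - 2))).fun_mul
      (H.hasDerivAt_logDeriv s hs))).deriv
  rw [hφ', hh', (H.hasDerivAt_logDeriv s hs).deriv, H.logDeriv_eq s hs, H.deriv_eq s hs]
  refine ⟨?_, by ring, by ring⟩
  linear_combination logDeriv f s ^ 2 * rootD_sq hn m k

theorem BaseODE.hasDerivAt_logDeriv {n m : ℝ} (H : BaseODE n m 1 I φ f h)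
    (hφ : IsSmoothNonzeroOn I φ) (hf : IsSmoothNonzeroOn I f) {s : ℝ} (hs : s ∈ I) :
    HasDerivAt (logDeriv φ)
        (((n - 2) * logDeriv φ s - m * logDeriv f s + deriv h s) * logDeriv φ s) s ∧
      HasDerivAt (logDeriv f)
        (((n - 2) * logDeriv φ s - m * logDeriv f s + deriv h s) * logDeriv f s) s :=
  ⟨(hasDerivAt_deriv hφ.isOpen hφ.contDiffOn_logDeriv hs).congr_deriv
      (by linear_combination (H s hs).2.1),
    (hasDerivAt_deriv hf.isOpen hf.contDiffOn_logDeriv hs).congr_deriv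
      (by linear_combination (H s hs).2.2)⟩

theorem BaseODE.logDeriv_ne_zero {n m : ℝ} (H : BaseODE n m 1 I φ f h)
    (hφ : IsSmoothNonzeroOn I φ) (hf : IsSmoothNonzeroOn I f) (hI : I.OrdConnected)
    (hh : ContDiffOn ℝ ∞ h I) (hnc : NonConstOn f I) : ∀ s ∈ I, logDeriv f s ≠ 0 := by
  obtain ⟨s₀, hs₀, hfs₀⟩ :=
    hnc.exists_deriv_ne_zero hf.isOpen hI (hf.smooth.differentiableOn (by simp))
  have hφc := hφ.contDiffOn_logDeriv.continuousOn
  have hfc := hf.contDiffOn_logDeriv.continuousOn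
  have hhc := (contDiffOn_deriv hφ.isOpen hh).continuousOn
  intro s hs h0
  have hlog₀ : logDeriv f s₀ ≠ 0 := div_ne_zero hfs₀ (hf.ne_zero s₀ hs₀)
  exact hlog₀ (eq_zero_of_linear_ode (F := logDeriv f)
    (a := fun r => (n - 2) * logDeriv φ r - m * logDeriv f r + deriv h r) hf.isOpen hI
    (by fun_prop) (fun r hr => (H.hasDerivAt_logDeriv hφ hf hr).2) hs h0 hs₀)

theorem BaseODE.exists_isReducedBase (H : BaseODE n m 1 I φ f h) (hn : 1 ≤ n)
    (hφ : IsSmoothNonzeroOn I φ) (hf : IsSmoothNonzeroOn I f) (hI : I.OrdConnected)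
    (hh : ContDiffOn ℝ ∞ h I) (hlog : ∀ s ∈ I, logDeriv f s ≠ 0) :
    ∃ k z, ContDiffOn ℝ ∞ z I ∧ IsReducedBase n m k z I φ f h := by
  obtain ⟨k, hk⟩ := exists_eq_const_mul_of_linear_ode hf.isOpen hI
    (fun s hs => (H.hasDerivAt_logDeriv hφ hf hs).1)
    (fun s hs => (H.hasDerivAt_logDeriv hφ hf hs).2) hlog
  have hh' := contDiffOn_deriv hf.isOpen hh
  let z s := deriv h s / logDeriv f s - m + k * (n - 2)
  have hz : ContDiffOn ℝ ∞ z I :=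
    ((hh'.div hf.contDiffOn_logDeriv hlog).sub contDiffOn_const).add contDiffOn_const
  have hdh : ∀ s ∈ I, deriv h s = (z s + m - k * (n - 2)) * logDeriv f s := fun s hs => by
    have hlogs := hlog s hs
    simp only [z]
    field_simp
    ring
  have hdlog : ∀ s ∈ I, HasDerivAt (logDeriv f) (z s * logDeriv f s ^ 2) s := fun s hs => by
    refine (H.hasDerivAt_logDeriv hφ hf hs).2.congr_deriv ?_
    rw [hk s hs, hdh s hs]
    ring
  refine ⟨k, z, hz, hf.isOpen, hk, hdh, hdlog, fun s hs => ?_⟩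
  have hdz := hasDerivAt_deriv hf.isOpen hz hs
  have hddh := (hasDerivAt_congr_of_eqOn hf.isOpen hdh hs
    (((hdz.add_const (m : ℝ)).sub_const (k * (n - 2))).fun_mul (hdlog s hs))).deriv
  have hdφ := (hasDerivAt_congr_of_eqOn hf.isOpen hk hs ((hdlog s hs).const_mul k)).deriv
  have hscalar := (H s hs).1
  rw [hdφ, (hdlog s hs).deriv, hddh, hdh s hs, hk s hs] at hscalar
  refine hdz.congr_deriv (mul_right_cancel₀ (hlog s hs) ?_)
  linear_combination hscalar - logDeriv f s ^ 2 * rootD_sq hn m k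

theorem BasePower.exists_isReducedBase (H : BasePower n m k I φ f h) (hn : 2 ≤ n) (hm : 1 ≤ m)
    (hI : IsOpen I) : ∃ N, IsReducedBase n m k (fun _ => N) I φ f h := by
  obtain ⟨N, c₄, c₅, c₇, b, hN, hc₄, hc₅, H⟩ := H
  have hN₀ : N ≠ 0 := ne_zero_of_eq_neg_add_or_sub_rootD hn hm hN
  have hne : ∀ s ∈ I, N * s + b ≠ 0 := fun s hs => (H s hs).1
  have hf : ∀ s ∈ I, logDeriv f s = -1 / (N * s + b) := fun s hs => by
    rw [logDeriv_eq_of_eq_mul_abs_affine_rpow (e := -(1 / N)) hI hc₅.ne' (fun r hr => by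
      rw [(H r hr).2.2.1, Real.rpow_neg (abs_nonneg _), div_eq_mul_inv]) hs (hne s hs)]
    field_simp
  have hφ : ∀ s ∈ I, logDeriv φ s = k * logDeriv f s := fun s hs => by
    rw [logDeriv_eq_of_eq_mul_abs_affine_rpow (e := -(k / N)) hI hc₄.ne' (fun r hr => by
      rw [(H r hr).2.1, Real.rpow_neg (abs_nonneg _), div_eq_mul_inv]) hs (hne s hs), hf s hs]
    field_simp
  refine ⟨N, hI, hφ, fun s hs => ?_, fun s hs => ?_, fun s _ => ?_⟩
  · rw [(hasDerivAt_congr_of_eqOn hI (fun r hr => (H r hr).2.2.2) hs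
      (((hasDerivAt_log_affine (hne s hs)).const_mul _).add_const c₇)).deriv, hf s hs]
    have := hne s hs
    field_simp
    ring
  · refine (hasDerivAt_congr_of_eqOn hI hf hs
      (hasDerivAt_const_div_affine (hne s hs) (-1))).congr_deriv ?_
    rw [hf s hs]
    field_simp
  · refine (hasDerivAt_const s N).congr_deriv ?_
    rcases hN with rfl | rfl <;> ring

theorem IsReducedBase.basePower (H : IsReducedBase n m k z I φ f h) (hn : 2 ≤ n) (hm : 1 ≤ m)
    (hφ : IsSmoothNonzeroOn I φ) (hφ₀ : ∀ s ∈ I, 0 < φ s) (hf : IsSmoothNonzeroOn I f)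
    (hf₀ : ∀ s ∈ I, 0 < f s) (hI : I.OrdConnected) (hh : ContDiffOn ℝ ∞ h I)
    (hlog : ∀ s ∈ I, logDeriv f s ≠ 0) (hN : N = -k + rootD n m k ∨ N = -k - rootD n m k)
    (hz : ∀ s ∈ I, z s = N) : BasePower n m k I φ f h := by
  have hN₀ : N ≠ 0 := ne_zero_of_eq_neg_add_or_sub_rootD hn hm hN
  obtain ⟨b, hb⟩ := exists_eq_neg_inv_affine_of_riccati hf.isOpen hI hlog
    fun s hs => hz s hs ▸ H.hasDerivAt_logDeriv s hs
  have hne : ∀ s ∈ I, N * s + b ≠ 0 := fun s hs => (hb s hs).1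
  obtain ⟨c₅, hc₅, hfeq⟩ :=
    exists_eq_mul_abs_affine_rpow hf hf₀ hI hN₀ hne fun s hs => (hb s hs).2
  obtain ⟨c₄, hc₄, hφeq⟩ := exists_eq_mul_abs_affine_rpow (c := -k) hφ hφ₀ hI hN₀ hne
    fun s hs => by rw [H.logDeriv_eq s hs, (hb s hs).2]; ring
  obtain ⟨c₇, hheq⟩ := exists_eq_mul_log_affine_add_const
    (c := -((m : ℝ) - ((n : ℝ) - 2) * k + N)) hf.isOpen hI hN₀ hne
    fun s hs => (hasDerivAt_deriv hf.isOpen hh hs).congr_deriv (by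
      rw [H.deriv_eq s hs, (hb s hs).2, hz s hs]; ring)
  refine ⟨N, c₄, c₅, c₇, b, hN, hc₄, hc₅, fun s hs => ⟨hne s hs, ?_, ?_, ?_⟩⟩
  · rw [hφeq s hs, neg_div, Real.rpow_neg (abs_nonneg _), ← div_eq_mul_inv]
  · rw [hfeq s hs, neg_div, Real.rpow_neg (abs_nonneg _), ← div_eq_mul_inv]
  · rw [hheq s hs, neg_div]

theorem signedPow_eq_mul_abs_rpow {x : ℝ} (hx : x ≠ 0) (p : ℝ) :
    signedPow x p = x * |x| ^ (p - 1) := by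
  have habs : Real.sign x * |x| = x := by
    rcases hx.lt_or_gt with h | h
    · rw [Real.sign_of_neg h, abs_of_neg h, neg_one_mul, neg_neg]
    · rw [Real.sign_of_pos h, abs_of_pos h, one_mul]
  rw [signedPow, Real.rpow_sub_one (abs_ne_zero.2 hx), mul_div_assoc',
    eq_div_iff (abs_ne_zero.2 hx), mul_right_comm, habs]

theorem hasDerivAt_aux_weight {D q s : ℝ} (hD : D ≠ 0) (hsub : z s + k - D ≠ 0)
    (hadd : z s + k + D ≠ 0)
    (hz : HasDerivAt z (-q * (z s + k - D) * (z s + k + D)) s) :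
    HasDerivAt (fun r => |z r + k - D| ^ ((k / D - 1) / 2) * |z r + k + D| ^ ((-(k / D) - 1) / 2))
      (z s * q * (|z s + k - D| ^ ((k / D - 1) / 2) * |z s + k + D| ^ ((-(k / D) - 1) / 2))) s := by
  refine ((hasDerivAt_abs_rpow ((hz.add_const k).sub_const D) hsub _).fun_mul
    (hasDerivAt_abs_rpow ((hz.add_const k).add_const D) hadd _)).congr_deriv ?_
  field_simp
  ring

theorem signedPow_mul_signedPow {A B : ℝ} (hA : A ≠ 0) (hB : B ≠ 0) (a : ℝ) :
    signedPow A ((a + 1) / 2) * signedPow B ((-a + 1) / 2) =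
      |A| ^ ((a - 1) / 2) * |B| ^ ((-a - 1) / 2) * A * B := by
  rw [signedPow_eq_mul_abs_rpow hA, signedPow_eq_mul_abs_rpow hB,
    show (a + 1) / 2 - 1 = (a - 1) / 2 by ring, show (-a + 1) / 2 - 1 = (-a - 1) / 2 by ring]
  ring

theorem BaseSystem.isReducedBase (H : BaseSystem n m k z I φ f h) (hD : rootD n m k ≠ 0)
    (hI : IsOpen I) (hz : ContDiffOn ℝ ∞ z I) : IsReducedBase n m k z I φ f h := by
  obtain ⟨a, c₆, ψ, rfl, H⟩ := H
  have hlog : ∀ s ∈ I, logDeriv f s =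
      c₆ * (|z s + k - rootD n m k| ^ ((k / rootD n m k - 1) / 2) *
        |z s + k + rootD n m k| ^ ((-(k / rootD n m k) - 1) / 2)) := fun s hs => by
    obtain ⟨-, hf, -, -, -, hψ, -⟩ := H s hs
    rw [logDeriv_apply, hf, hψ, mul_assoc]
  have hdz : ∀ s ∈ I, HasDerivAt z
      (-logDeriv f s * (z s + k - rootD n m k) * (z s + k + rootD n m k)) s := fun s hs => by
    obtain ⟨-, -, -, hsub, hadd, -, hz'⟩ := H s hs
    refine (hasDerivAt_deriv hI hz hs).congr_deriv ?_
    rw [hz', mul_assoc, signedPow_mul_signedPow hsub hadd, hlog s hs]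
    ring
  refine ⟨hI, fun s hs => (H s hs).1, fun s hs => ?_, fun s hs => ?_, hdz⟩
  · obtain ⟨-, hf, hh, -⟩ := H s hs
    rw [hh, logDeriv_apply, hf]
  · obtain ⟨-, -, -, hsub, hadd, -, -⟩ := H s hs
    refine (hasDerivAt_congr_of_eqOn hI hlog hs
      ((hasDerivAt_aux_weight hD hsub hadd (hdz s hs)).const_mul c₆)).congr_deriv ?_
    rw [hlog s hs]
    ring

theorem IsReducedBase.baseSystem (H : IsReducedBase n m k z I φ f h) (hI : I.OrdConnected)
    (hD : rootD n m k ≠ 0) (hsub : ∀ s ∈ I, z s + k - rootD n m k ≠ 0)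
    (hadd : ∀ s ∈ I, z s + k + rootD n m k ≠ 0) : BaseSystem n m k z I φ f h := by
  obtain ⟨c₆, hc₆⟩ := exists_eq_const_mul_of_linear_ode (a := fun s => z s * logDeriv f s)
    H.isOpen hI (fun s hs => (H.hasDerivAt_logDeriv s hs).congr_deriv (by ring))
    (fun s hs => hasDerivAt_aux_weight hD (hsub s hs) (hadd s hs) (H.hasDerivAt_aux s hs))
    fun s hs => mul_ne_zero (Real.rpow_pos_of_pos (abs_pos.2 (hsub s hs)) _).ne'
      (Real.rpow_pos_of_pos (abs_pos.2 (hadd s hs)) _).ne'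
  refine ⟨k / rootD n m k, c₆, logDeriv f, rfl, fun s hs => ⟨H.logDeriv_eq s hs, rfl,
    H.deriv_eq s hs, hsub s hs, hadd s hs, by rw [hc₆ s hs, mul_assoc], ?_⟩⟩
  rw [(H.hasDerivAt_aux s hs).deriv, hc₆ s hs, mul_assoc (-c₆),
    signedPow_mul_signedPow (hsub s hs) (hadd s hs)]
  ring

theorem IsReducedBase.eq_or_forall_ne (H : IsReducedBase n m k z I φ f h) (hI : I.OrdConnected)
    (hf : IsSmoothNonzeroOn I f) (hz : ContDiffOn ℝ ∞ z I) :
    (∃ N, (N = -k + rootD n m k ∨ N = -k - rootD n m k) ∧ ∀ s ∈ I, z s = N) ∨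
      ∀ s ∈ I, z s + k - rootD n m k ≠ 0 ∧ z s + k + rootD n m k ≠ 0 := by
  have hzc := hz.continuousOn
  have hfc := hf.contDiffOn_logDeriv.continuousOn
  refine or_iff_not_imp_right.2 fun hzero => ?_
  push Not at hzero
  obtain ⟨s, hs, hs₀⟩ := hzero
  by_cases hsub : z s + k - rootD n m k = 0
  · refine ⟨-k + rootD n m k, Or.inl rfl, fun r hr => ?_⟩
    linarith [eq_zero_of_linear_ode (F := fun s => z s + k - rootD n m k)
      (a := fun s => -logDeriv f s * (z s + k + rootD n m k)) H.isOpen hI (by fun_prop)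
      (fun t ht => (((H.hasDerivAt_aux t ht).add_const k).sub_const _).congr_deriv (by ring))
      hs hsub hr]
  · refine ⟨-k - rootD n m k, Or.inr rfl, fun r hr => ?_⟩
    linarith [eq_zero_of_linear_ode (F := fun s => z s + k + rootD n m k)
      (a := fun s => -logDeriv f s * (z s + k - rootD n m k)) H.isOpen hI (by fun_prop)
      (fun t ht => ((H.hasDerivAt_aux t ht).add_const k).add_const _) hs (hs₀ hsub) hr]

theorem IsReducedBase.nonConstOn (H : IsReducedBase n m k z I φ f h) {s : ℝ} (hs : s ∈ I)
    (hlog : logDeriv f s ≠ 0) (hsub : z s + k - rootD n m k ≠ 0)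
    (hadd : z s + k + rootD n m k ≠ 0) : NonConstOn z I := by
  by_contra hconst
  have hzeq : ∀ x ∈ I, ∀ y ∈ I, z x = z y := by simpa [NonConstOn] using hconst
  have hzero := (H.hasDerivAt_aux s hs).unique (hasDerivAt_congr_of_eqOn H.isOpen
    (fun r hr => hzeq r hr s hs) hs (hasDerivAt_const s (z s)))
  exact mul_ne_zero (mul_ne_zero (neg_ne_zero.2 hlog) hsub) hadd hzero

theorem baseODE_one_iff_baseUnit (hn : 2 ≤ n) (hm : 1 ≤ m) (hφ : IsSmoothNonzeroOn I φ)
    (hφ₀ : ∀ s ∈ I, 0 < φ s) (hf : IsSmoothNonzeroOn I f) (hf₀ : ∀ s ∈ I, 0 < f s)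
    (hI : I.OrdConnected) (hh : ContDiffOn ℝ ∞ h I) (hnc : NonConstOn f I) :
    BaseODE n m 1 I φ f h ↔ BaseUnit n m I φ f h := by
  have hn' : 1 ≤ n := one_le_two.trans hn
  constructor
  · intro H
    have hlog := H.logDeriv_ne_zero hφ hf hI hh hnc
    obtain ⟨k, z, hz, hred⟩ := H.exists_isReducedBase hn' hφ hf hI hh hlog
    refine ⟨k, z, hz, fun s hs => ⟨hred.logDeriv_eq s hs, ?_⟩, ?_⟩
    · rw [hred.deriv_eq s hs, logDeriv_apply]
      ring
    rcases hred.eq_or_forall_ne hI hf hz with ⟨N, hN, hzN⟩ | hne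
    · exact Or.inl ⟨⟨N, ne_zero_of_eq_neg_add_or_sub_rootD hn hm hN, hzN⟩,
        hred.basePower hn hm hφ hφ₀ hf hf₀ hI hh hlog hN hzN⟩
    · obtain ⟨s, hs, -⟩ := hnc
      exact Or.inr ⟨hred.nonConstOn hs (hlog s hs) (hne s hs).1 (hne s hs).2,
        hred.baseSystem hI (rootD_pos hn hm k).ne' (fun r hr => (hne r hr).1)
          fun r hr => (hne r hr).2⟩
  · rintro ⟨k, z, hz, -, ⟨-, hpower⟩ | ⟨-, hsystem⟩⟩
    · obtain ⟨N, hred⟩ := hpower.exists_isReducedBase hn hm hf.isOpen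
      exact hred.baseODE hn' 1
    · exact (hsystem.isReducedBase (rootD_pos hn hm k).ne' hf.isOpen hz).baseODE hn' 1

end UnitBase

end RicciHarmonic

end

theorem theorem5 (n m : ℕ) (hn : 1 < n) (hm : 3 ≤ m)
    (ε α : Fin n → ℝ) (δ β : Fin m → ℝ)
    (hε : ∀ i, ε i = 1 ∨ ε i = -1) (hδ : ∀ j, δ j = 1 ∨ δ j = -1)
    (hα : α ≠ 0) (hβ : β ≠ 0) (θ : ℝ) (hθ : 0 < θ)
    (I J : Set ℝ) (hI : IsOpen I) (hI' : I.OrdConnected) (hJ : IsOpen J) (hJ' : J.OrdConnected)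
    (ξ₀ ζ₀ : ℝ) (hξ₀ : ξ₀ ∈ I) (hζ₀ : ζ₀ ∈ J)
    (φ f h τ u : ℝ → ℝ)
    (hφ : ContDiffOn ℝ ∞ φ I) (hf : ContDiffOn ℝ ∞ f I) (hh : ContDiffOn ℝ ∞ h I)
    (hτ : ContDiffOn ℝ ∞ τ J) (hu : ContDiffOn ℝ ∞ u J)
    (hφ0 : ∀ ξ ∈ I, 0 < φ ξ) (hf0 : ∀ ξ ∈ I, 0 < f ξ) (hτ0 : ∀ ζ ∈ J, 0 < τ ζ)
    (hu_nc : NonConstOn u J) :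
    (sqNorm ε α = 0 → sqNorm δ β = 0 →
      (IsSteadyWithSteadyFiber ε α δ β θ I J φ f h τ u ↔
        BaseNull n m I ξ₀ φ f h ∧ FiberNull m θ J ζ₀ τ u)) ∧
    (sqNorm ε α = 0 → sqNorm δ β = 1 →
      (IsSteadyWithSteadyFiber ε α δ β θ I J φ f h τ u ↔
        BaseNull n m I ξ₀ φ f h ∧ FiberUnit m θ J τ u)) ∧
    (sqNorm ε α = 1 → sqNorm δ β = 0 → NonConstOn f I →
      (IsSteadyWithSteadyFiber ε α δ β θ I J φ f h τ u ↔
        BaseUnit n m I φ f h ∧ FiberNull m θ J ζ₀ τ u)) ∧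
    (sqNorm ε α = 1 → sqNorm δ β = 1 → NonConstOn f I →
      (IsSteadyWithSteadyFiber ε α δ β θ I J φ f h τ u ↔
        BaseUnit n m I φ f h ∧ FiberUnit m θ J τ u)) := by
  have hφ' : IsSmoothNonzeroOn I φ := ⟨hI, hφ, fun s hs => (hφ0 s hs).ne'⟩
  have hf' : IsSmoothNonzeroOn I f := ⟨hI, hf, fun s hs => (hf0 s hs).ne'⟩
  have hτ' : IsSmoothNonzeroOn J τ := ⟨hJ, hτ, fun s hs => (hτ0 s hs).ne'⟩
  have hBaseNull := baseODE_zero_iff_baseNull (n := n) (m := m) hφ' hf' hI' hh hξ₀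
  have hBaseUnit := baseODE_one_iff_baseUnit (m := m) hn (by lia) hφ' hφ0 hf' hf0 hI' hh
  have hFiberNull := fiberODE_zero_iff_fiberNull hm hθ hτ' hJ' hζ₀ hu
  have hFiberUnit := fiberODE_one_iff_fiberUnit hm hθ hτ' hτ0 hJ' hu hu_nc
  rw [isSteadyWithSteadyFiber_iff hn (by lia) hθ.le hε hδ hα hβ ⟨ζ₀, hζ₀⟩ hφ' hf' hh hτ' hu]
  refine ⟨fun hα₀ hβ₀ => ?_, fun hα₀ hβ₁ => ?_, fun hα₁ hβ₀ hnc => ?_, fun hα₁ hβ₁ hnc => ?_⟩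
  · rw [hα₀, hβ₀, hBaseNull, hFiberNull]
  · rw [hα₀, hβ₁, hBaseNull, hFiberUnit]
  · rw [hα₁, hβ₀, hBaseUnit hnc, hFiberNull]
  · rw [hα₁, hβ₁, hBaseUnit hnc, hFiberUnit]
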